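/- An inverse semigroup is a semigroup $S$ in which every $s$ has a unique inverse $s^{-1}$ ($ss^{-1}s=s$, $s^{-1}ss^{-1}=s^{-1}$); $E(S)$ is its set of idempotents, and $s\le t$ means $s=et$ for some $e\in E(S)$. It is $E$-unitary if $e\in E(S)$, $e\le s$ imply $s\in E(S)$. Let $G$ be a group and $(A,\theta)$ a partial $G$-module: a commutative inverse semigroup $A$ (equivalently, a semilattice of abelian groups $A=\bigsqcup_{e\in E(A)}A_e$, $A_e=\{a: aa^{-1}=e\}$) with isomorphisms $\theta_x:\mathcal D_{x^{-1}}\to\mathcal D_x$ $(x\in G)$ between non-empty ideals of $A$ such that $\mathcal D_1=A$, $\theta_1=\mathrm{id}_A$, $\theta_x(\mathcal D_{x^{-1}}\cap\mathcal D_y)=\mathcal D_x\cap\mathcal D_{xy}$, and $\theta_x\theta_y(a)=\theta_{xy}(a)$ for $a\in\mathcal D_{y^{-1}}\cap\mathcal D_{y^{-1}x^{-1}}$. Cohomology. A multiplier of a semigroup $I$ is a pair of maps $a\mapsto wa$, $a\mapsto aw$ from $I$ to $I$ with $w(ab)=(wa)b$, $(ab)w=a(bw)$, $a(wb)=(aw)b$;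 multipliers form a monoid $\mathcal M(I)$ with group of units $\mathcal U(\mathcal M(I))$ (commutative if $I$ is a commutative inverse semigroup). Put $C^0(G,A)=\mathcal U(\mathcal M(A))$, $C^1(G,A)=\prod_{x}\mathcal U(\mathcal M(\mathcal D_x))$, $C^2(G,A)=\prod_{x,y}\mathcal U(\mathcal M(\mathcal D_x\cap\mathcal D_{xy}))$, with $(\delta^0w)(x)a=\theta_x(\theta_x^{-1}(a)w)w^{-1}$ for $a\in\mathcal D_x$ and $(\delta^1w)(x,y)a=\theta_x(\theta_x^{-1}(a)w(y))\,w(xy)^{-1}w(x)$ for $a\in\mathcal D_x\cap\mathcal D_{xy}$. Then $Z^1(G,A)=\ker\delta^1$, $B^1(G,A)=\operatorname{im}\delta^0$ and $H^1(G,A)=Z^1(G,A)/B^1(G,A)$. Extensions. An extension of $A$ by $G$ is an inverse semigroup $U$ with an injective homomorphism $i:A\to U$ and a surjective homomorphism $j:U\to G$ such that $i(A)=j^{-1}(1)$. A refinement of it is a factorization $j=\kappa\circ\pi$ into surjective homomorphisms $U\overset{\pi}{\to}S\overset{\kappa}{\to}G$, where $S$ is an $E$-unitary inverse semigroup, $\pi$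 is injective on $E(U)$ and $i(A)=\pi^{-1}(E(S))$. An order-preserving transversal of $\pi$ is a map $\rho:S\to U$ with $\pi\circ\rho=\mathrm{id}$, $\rho(E(S))\subseteq E(U)$, and $\rho(s)\le\rho(t)$ whenever $s\le t$. The extension is an extension of $(A,\theta)$ by $G$ if it has a refinement and an order-preserving transversal $\rho$ of $\pi$ which induce $\theta$, that is, with $\alpha=i^{-1}\circ\rho|_{E(S)}$: $\mathcal D_x=\bigsqcup_{\kappa(s)=x}A_{\alpha(ss^{-1})}$, and $\theta_x(a)=i^{-1}(\rho(s)i(a)\rho(s)^{-1})$ whenever $\kappa(s)=x$ and $\alpha(s^{-1}s)=aa^{-1}$. Splittings. For $x\in G$, $e\in E(U)$ let $U(x,e)=\{u\in U: j(u)=x,\ uu^{-1}=e\}$. A splitting of $U$ is a partial map $\tau:G\times E(U)\dashrightarrow U$ such that $\tau(x,e)$ is defined if and only if $U(x,e)\neq\emptyset$, $\tau(x,e)\in U(x,e)$ whenever it is defined, $\tau(1,e)=e$, and $\tau(x,e)\tau(y,f)=\tau(xy,\tau(x,e)f\tau(x,e)^{-1})$ (if the left-hand side is defined, then so is the right-hand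 side, and they coincide). The extension splits if it has a splitting. Splittings $\tau,\tau'$ are equivalent if there is an order-preserving $\eta:E(U)\to A$ with $\eta(e)\in A_{i^{-1}(e)}$ for all $e$, such that $\tau'(x,e)=i(\eta(e))\,\tau(x,e)\,i\big(\eta(\tau(x,e)^{-1}e\,\tau(x,e))\big)^{-1}$ whenever $\tau(x,e)$ is defined; this is an equivalence relation. **Theorem.** Let $A\overset{i}{\to}U\overset{j}{\to}G$ be a split extension of a partial $G$-module $(A,\theta)$ by $G$. Then the equivalence classes of splittings of $U$ are in one-to-one correspondence with the elements of $H^1(G,A)$. More precisely, for every splitting $\tau_0$ of $U$ there is a bijection $\Phi$ from the set of equivalence classes of splittings onto $H^1(G,A)$ such that for each splitting $\tau$ there is $w\in Z^1(G,A)$ with $\Phi([\tau])=[w]$ and $\tau(x,e)=i\big(w(x)\,i^{-1}(e)\big)\,\tau_0(x,e)$ for all $x\in G$, $e\in E(U)$ with $i^{-1}(e)\in\mathcal D_x$ and $\tau_0(x,e)$ defined. -/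

import Mathlib

namespace PartialCohomology

universe u v w

/-! ### Inverse semigroups -/

/-- An inverse semigroup: every `s` has exactly one inverse, i.e. exactly one `t` with
`s * t * s = s` and `t * s * t = t`; it is written `s⁻¹`. -/
class InverseSemigroup (S : Type u) extends Semigroup S, Inv S where
  mul_inv_mul_self : ∀ s : S, s * s⁻¹ * s = s
  inv_mul_inv_self : ∀ s : S, s⁻¹ * s * s⁻¹ = s⁻¹
  eq_inv_of : ∀ s t : S, s * t * s = s → t * s * t = t → t = s⁻¹

/-- A commutative inverse semigroup, i.e. a semilattice of abelian groups: the disjoint union of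
its abelian subgroups `A_e = {a | a * a⁻¹ = e}`, `e` idempotent. -/
class CommInverseSemigroup (A : Type u) extends InverseSemigroup A, CommSemigroup A

/-- The set `E(S)` of idempotents. -/
abbrev Idem (S : Type u) [Mul S] : Type u := {e : S // IsIdempotentElem e}

/-- The natural partial order: `s ≤ t` iff `s = e * t` for some idempotent `e`. -/
def NatLE {S : Type u} [InverseSemigroup S] (s t : S) : Prop :=
  ∃ e : S, IsIdempotentElem e ∧ s = e * t

/-- An inverse semigroup is `E`-unitary if every element above an idempotent is idempotent. -/
def EUnitary (S : Type u) [InverseSemigroup S] : Prop :=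
  ∀ e s : S, IsIdempotentElem e → NatLE e s → IsIdempotentElem s

namespace InverseSemigroup

variable {S : Type u} [InverseSemigroup S]

theorem inv_eq_self {e : S} (he : IsIdempotentElem e) : e⁻¹ = e := by
  have h : e * e = e := he
  exact (eq_inv_of e e (by rw [h, h]) (by rw [h, h])).symm

theorem inv_inv' (s : S) : s⁻¹⁻¹ = s :=
  (eq_inv_of s⁻¹ s (inv_mul_inv_self s) (mul_inv_mul_self s)).symm

theorem idem_mul_inv (s : S) : IsIdempotentElem (s * s⁻¹) := by
  change s * s⁻¹ * (s * s⁻¹) = s * s⁻¹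
  rw [← mul_assoc, mul_inv_mul_self]

theorem idem_inv_mul (s : S) : IsIdempotentElem (s⁻¹ * s) := by
  change s⁻¹ * s * (s⁻¹ * s) = s⁻¹ * s
  rw [← mul_assoc, inv_mul_inv_self]

theorem idem_mul {e f : S} (he : IsIdempotentElem e) (hf : IsIdempotentElem f) :
    IsIdempotentElem (e * f) := by
  have he' : ∀ t, e * (e * t) = e * t := fun t => by rw [← mul_assoc, he.eq]
  have hf' : ∀ t, f * (f * t) = f * t := fun t => by rw [← mul_assoc, hf.eq]
  set x := (e * f)⁻¹ with hx
  have h1 : e * (f * (x * (e * f))) = e * f := by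
    have := mul_inv_mul_self (e * f)
    simpa only [mul_assoc] using this
  have h2 : x * (e * (f * x)) = x := by
    have := inv_mul_inv_self (e * f)
    simpa only [mul_assoc] using this
  have h2' : ∀ t, x * (e * (f * (x * t))) = x * t := fun t => by
    have := congrArg (· * t) h2
    simpa only [mul_assoc] using this
  have key : f * (x * e) = x := by
    apply eq_inv_of
    · simp only [mul_assoc, he', hf', h1]
    · simp only [mul_assoc, he', hf', h2']
  have hxi : IsIdempotentElem x := by
    change x * x = x
    calc x * x = f * (x * e) * (f * (x * e)) := by rw [key]
      _ = f * (x * e) := by simp only [mul_assoc, h2']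
      _ = x := key
  have : e * f = x := by rw [← inv_inv' (e * f), ← hx, inv_eq_self hxi]
  rw [this]; exact hxi

theorem idem_comm {e f : S} (he : IsIdempotentElem e) (hf : IsIdempotentElem f) :
    e * f = f * e := by
  have he' : ∀ t, e * (e * t) = e * t := fun t => by rw [← mul_assoc, he.eq]
  have hf' : ∀ t, f * (f * t) = f * t := fun t => by rw [← mul_assoc, hf.eq]
  have h1 : e * (f * (e * f)) = e * f := by
    have := (idem_mul he hf).eq
    simpa only [mul_assoc] using this
  have h2 : f * (e * (f * e)) = f * e := by
    have := (idem_mul hf he).eq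
    simpa only [mul_assoc] using this
  have : f * e = (e * f)⁻¹ := by
    apply eq_inv_of
    · simp only [mul_assoc, he', hf', h1]
    · simp only [mul_assoc, he', hf', h2]
  rw [this, inv_eq_self (idem_mul he hf)]

theorem mul_inv_rev' (s t : S) : (s * t)⁻¹ = t⁻¹ * s⁻¹ := by
  have hc := idem_comm (idem_mul_inv t) (idem_inv_mul s)
  symm
  apply eq_inv_of
  · calc s * t * (t⁻¹ * s⁻¹) * (s * t) = s * (t * t⁻¹ * (s⁻¹ * s)) * t := by
          simp only [mul_assoc]
      _ = s * s⁻¹ * s * (t * t⁻¹ * t) := by rw [hc]; simp only [mul_assoc]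
      _ = s * t := by rw [mul_inv_mul_self, mul_inv_mul_self]
  · calc t⁻¹ * s⁻¹ * (s * t) * (t⁻¹ * s⁻¹) = t⁻¹ * (s⁻¹ * s * (t * t⁻¹)) * s⁻¹ := by
          simp only [mul_assoc]
      _ = t⁻¹ * t * t⁻¹ * (s⁻¹ * s * s⁻¹) := by rw [← hc]; simp only [mul_assoc]
      _ = t⁻¹ * s⁻¹ := by rw [inv_mul_inv_self, inv_mul_inv_self]

theorem idem_conj (s : S) {f : S} (hf : IsIdempotentElem f) :
    IsIdempotentElem (s * f * s⁻¹) := by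
  have hc := idem_comm (idem_inv_mul s) hf
  change s * f * s⁻¹ * (s * f * s⁻¹) = s * f * s⁻¹
  calc s * f * s⁻¹ * (s * f * s⁻¹) = s * f * (s⁻¹ * s * f) * s⁻¹ := by simp only [mul_assoc]
    _ = s * (f * f) * (s⁻¹ * s * s⁻¹) := by rw [hc]; simp only [mul_assoc]
    _ = s * f * s⁻¹ := by rw [hf.eq, inv_mul_inv_self]

theorem idem_conj' (s : S) {f : S} (hf : IsIdempotentElem f) :
    IsIdempotentElem (s⁻¹ * f * s) := by
  have := idem_conj s⁻¹ hf
  rwa [inv_inv'] at this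

theorem map_inv' {T : Type v} [InverseSemigroup T] (i : S →ₙ* T) (s : S) : i s⁻¹ = (i s)⁻¹ := by
  apply eq_inv_of
  · rw [← map_mul, ← map_mul, mul_inv_mul_self]
  · rw [← map_mul, ← map_mul, inv_mul_inv_self]

end InverseSemigroup

/-! ### Ideals and multipliers -/

/-- A (two-sided, possibly empty) ideal of a semigroup. -/
structure SIdeal (S : Type u) [Semigroup S] where
  carrier : Set S
  mul_mem_left : ∀ s a : S, a ∈ carrier → s * a ∈ carrier
  mul_mem_right : ∀ a s : S, a ∈ carrier → a * s ∈ carrier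

namespace SIdeal

variable {S : Type u} [Semigroup S]

instance : SetLike (SIdeal S) S where
  coe := carrier
  coe_injective := by rintro ⟨I, _, _⟩ ⟨J, _, _⟩ h; cases h; rfl

instance : MulMemClass (SIdeal S) S where
  mul_mem {I a _} _ hb := I.mul_mem_left a _ hb

/-- The intersection of two ideals. In an inverse semigroup it coincides with their product, since
there `s = s * (s⁻¹ * s)`. -/
def inter (I J : SIdeal S) : SIdeal S where
  carrier := {a | a ∈ I ∧ a ∈ J}
  mul_mem_left s a h := ⟨I.mul_mem_left s a h.1, J.mul_mem_left s a h.2⟩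
  mul_mem_right a s h := ⟨I.mul_mem_right a s h.1, J.mul_mem_right a s h.2⟩

theorem inter_le_left {I J : SIdeal S} : ∀ a ∈ I.inter J, a ∈ I := fun _ h => h.1

theorem inter_le_right {I J : SIdeal S} : ∀ a ∈ I.inter J, a ∈ J := fun _ h => h.2

/-- The whole semigroup, as an ideal of itself. -/
def whole (S : Type u) [Semigroup S] : SIdeal S where
  carrier := Set.univ
  mul_mem_left _ _ _ := trivial
  mul_mem_right _ _ _ := trivial

theorem mem_whole (s : S) : s ∈ whole S := trivial

/-- The identification of a semigroup with its largest ideal. -/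
def wholeEquiv (S : Type u) [Semigroup S] : S ≃* whole S where
  toFun s := ⟨s, trivial⟩
  invFun s := s
  left_inv _ := rfl
  right_inv _ := rfl
  map_mul' _ _ := rfl

/-- Ideals of a commutative inverse semigroup are commutative inverse semigroups. -/
instance {A : Type u} [CommInverseSemigroup A] (I : SIdeal A) : CommInverseSemigroup I where
  toSemigroup := MulMemClass.toSemigroup I
  mul_comm a b := Subtype.ext (mul_comm (a : A) b)
  inv a := ⟨(a : A)⁻¹, by
    have := I.mul_mem_left ((a : A)⁻¹ * (a : A)⁻¹) a a.2
    rwa [mul_right_comm, InverseSemigroup.inv_mul_inv_self] at this⟩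
  mul_inv_mul_self a := Subtype.ext (InverseSemigroup.mul_inv_mul_self (a : A))
  inv_mul_inv_self a := Subtype.ext (InverseSemigroup.inv_mul_inv_self (a : A))
  eq_inv_of a b h h' := Subtype.ext (InverseSemigroup.eq_inv_of (a : A) b
    (congrArg Subtype.val h) (congrArg Subtype.val h'))

end SIdeal

/-- A multiplier `m` of a semigroup: a pair of maps `s ↦ m s` (`left`) and `s ↦ s m` (`right`)
which are linked left and right translations. -/
@[ext]
structure Multiplier (S : Type u) [Semigroup S] where
  left : S → S
  right : S → S
  left_mul : ∀ s t, left (s * t) = left s * t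
  mul_right : ∀ s t, right (s * t) = s * right t
  linked : ∀ s t, s * left t = right s * t

namespace Multiplier

/-- The multipliers form a monoid under composition: `(m n) s = m (n s)`, `s (m n) = (s m) n`. -/
instance {S : Type u} [Semigroup S] : Monoid (Multiplier S) where
  mul m n :=
    { left := fun s => m.left (n.left s)
      right := fun s => n.right (m.right s)
      left_mul := fun s t => by rw [n.left_mul, m.left_mul]
      mul_right := fun s t => by rw [m.mul_right, n.mul_right]
      linked := fun s t => by rw [m.linked, n.linked] }
  one :=
    { left := id
      right := id
      left_mul := fun _ _ => rfl
      mul_right := fun _ _ => rfl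
      linked := fun _ _ => rfl }
  mul_assoc _ _ _ := rfl
  one_mul _ := rfl
  mul_one _ := rfl

variable {A : Type u} [CommInverseSemigroup A]

/-- Left and right actions of a multiplier of a commutative inverse semigroup coincide. -/
theorem left_eq_right (m : Multiplier A) (a : A) : m.left a = m.right a := by
  have h : ∀ b c : A, m.left (b * c) = m.right (b * c) := fun b c => by
    rw [m.left_mul, mul_comm, m.linked, mul_comm, ← m.mul_right]
  rw [← InverseSemigroup.mul_inv_mul_self a, h]

theorem left_left_comm (m n : Multiplier A) (a : A) :
    m.left (n.left a) = n.left (m.left a) := by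
  have h : ∀ b c : A, m.left (n.left (b * c)) = n.left (m.left (b * c)) := fun b c => by
    rw [n.left_mul, mul_comm, m.left_mul, mul_comm b c, m.left_mul, mul_comm (m.left c) b,
      n.left_mul, mul_comm]
  rw [← InverseSemigroup.mul_inv_mul_self a, h]

/-- Multipliers of a commutative inverse semigroup commute. -/
instance : CommMonoid (Multiplier A) where
  mul_comm m n := by
    ext a
    · exact left_left_comm m n a
    · change n.right (m.right a) = m.right (n.right a)
      simp only [← left_eq_right, left_left_comm]

theorem left_mem {J : SIdeal A} (m : Multiplier J) (I : SIdeal A) (a : J) (ha : (a : A) ∈ I) :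
    (m.left a : A) ∈ I := by
  have h : m.left a = m.left (a * a⁻¹) * a := by
    rw [← m.left_mul, InverseSemigroup.mul_inv_mul_self]
  rw [h]
  exact I.mul_mem_left _ _ ha

theorem right_mem {J : SIdeal A} (m : Multiplier J) (I : SIdeal A) (a : J) (ha : (a : A) ∈ I) :
    (m.right a : A) ∈ I := by
  rw [← m.left_eq_right]
  exact m.left_mem I a ha

/-- A multiplier of an ideal `J` restricts to every ideal `I ⊆ J`. -/
def restrict {I J : SIdeal A} (h : ∀ a ∈ I, a ∈ J) : Multiplier J →* Multiplier I where
  toFun m :=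
    { left := fun a => ⟨m.left ⟨a, h a a.2⟩, m.left_mem I ⟨a, h a a.2⟩ a.2⟩
      right := fun a => ⟨m.right ⟨a, h a a.2⟩, m.right_mem I ⟨a, h a a.2⟩ a.2⟩
      left_mul := fun a b => by
        have := congrArg Subtype.val (m.left_mul ⟨a, h a a.2⟩ ⟨b, h b b.2⟩)
        exact Subtype.ext this
      mul_right := fun a b => by
        have := congrArg Subtype.val (m.mul_right ⟨a, h a a.2⟩ ⟨b, h b b.2⟩)
        exact Subtype.ext this
      linked := fun a b => by
        have := congrArg Subtype.val (m.linked ⟨a, h a a.2⟩ ⟨b, h b b.2⟩)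
        exact Subtype.ext this }
  map_one' := rfl
  map_mul' _ _ := rfl

/-- Transport of multipliers along an isomorphism `φ`: `a ↦ φ (m (φ⁻¹ a))`. -/
def map {S : Type u} {T : Type v} [Semigroup S] [Semigroup T] (φ : S ≃* T) :
    Multiplier S →* Multiplier T where
  toFun m :=
    { left := fun t => φ (m.left (φ.symm t))
      right := fun t => φ (m.right (φ.symm t))
      left_mul := fun s t => by rw [map_mul, m.left_mul, map_mul, φ.apply_symm_apply]
      mul_right := fun s t => by rw [map_mul, m.mul_right, map_mul, φ.apply_symm_apply]
      linked := fun s t => by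
        have := congrArg φ (m.linked (φ.symm s) (φ.symm t))
        simpa only [map_mul, φ.apply_symm_apply] using this }
  map_one' := by ext t <;> exact φ.apply_symm_apply t
  map_mul' m n := by
    ext t
    · change φ (m.left (n.left (φ.symm t))) = φ (m.left (φ.symm (φ (n.left (φ.symm t)))))
      rw [φ.symm_apply_apply]
    · change φ (n.right (m.right (φ.symm t))) = φ (n.right (φ.symm (φ (m.right (φ.symm t)))))
      rw [φ.symm_apply_apply]

end Multiplier

/-! ### Partial modules and their cohomology -/

/-- A partial action of a group `G` on a semigroup `A`: isomorphisms `θ x : D x⁻¹ ≃* D x` between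
non-empty ideals of `A`. If `A` is a commutative inverse semigroup, this is a partial `G`-module. -/
structure PartialAction (G : Type u) (A : Type v) [Group G] [Semigroup A] where
  D : G → SIdeal A
  nonempty : ∀ x, ∃ a, a ∈ D x
  θ : ∀ x, D x⁻¹ ≃* D x
  D_one : ∀ a, a ∈ D 1
  θ_one : ∀ a : D 1⁻¹, (θ 1 a : A) = a
  image_inter : ∀ x y,
    (fun a => (θ x a : A)) '' {a | (a : A) ∈ D y} = {b | b ∈ D x ∧ b ∈ D (x * y)}
  θ_comp : ∀ (x y : G) (a : A) (hy : a ∈ D y⁻¹) (hxy : a ∈ D (x * y)⁻¹)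
    (h : (θ y ⟨a, hy⟩ : A) ∈ D x⁻¹), (θ x ⟨θ y ⟨a, hy⟩, h⟩ : A) = θ (x * y) ⟨a, hxy⟩

namespace PartialAction

variable {G : Type u} {A : Type v} [Group G] [CommInverseSemigroup A] (P : PartialAction G A)

/-- `D_(x,y) = D_x D_xy`, the product of the ideals being their intersection. -/
abbrev D₂ (x y : G) : SIdeal A := (P.D x).inter (P.D (x * y))

theorem θ_mem_D₂ (x y : G) (a : (P.D x⁻¹).inter (P.D y)) :
    (P.θ x ⟨a, a.2.1⟩ : A) ∈ P.D₂ x y := by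
  have : (P.θ x ⟨a, a.2.1⟩ : A) ∈ (fun a => (P.θ x a : A)) '' {a | (a : A) ∈ P.D y} :=
    ⟨⟨a, a.2.1⟩, a.2.2, rfl⟩
  rw [P.image_inter] at this
  exact this

theorem θ_symm_mem (x y : G) (b : P.D₂ x y) :
    ((P.θ x).symm ⟨b, b.2.1⟩ : A) ∈ (P.D x⁻¹).inter (P.D y) := by
  have : (b : A) ∈ (fun a => (P.θ x a : A)) '' {a | (a : A) ∈ P.D y} := by
    rw [P.image_inter]; exact b.2
  obtain ⟨a, ha, hab⟩ := this
  have : (⟨b, b.2.1⟩ : P.D x) = P.θ x a := Subtype.ext hab.symm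
  rw [this, MulEquiv.symm_apply_apply]
  exact ⟨a.2, ha⟩

/-- The restriction of `θ x` to an isomorphism `D_{x⁻¹} ∩ D_y ≃ D_x ∩ D_{xy}`. -/
def θ₂ (x y : G) : (P.D x⁻¹).inter (P.D y) ≃* P.D₂ x y where
  toFun a := ⟨P.θ x ⟨a, a.2.1⟩, P.θ_mem_D₂ x y a⟩
  invFun b := ⟨(P.θ x).symm ⟨b, b.2.1⟩, P.θ_symm_mem x y b⟩
  left_inv a := Subtype.ext (by simp)
  right_inv b := Subtype.ext (by simp)
  map_mul' a b := by
    have := congrArg Subtype.val (map_mul (P.θ x) (⟨a, a.2.1⟩ : P.D x⁻¹) ⟨b, b.2.1⟩)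
    exact Subtype.ext this

/-- Partial `0`-cochains: invertible multipliers of `A`. -/
abbrev C0 (_P : PartialAction G A) : Type v := (Multiplier A)ˣ

/-- Partial `1`-cochains: families of invertible multipliers of the ideals `D_x`. -/
abbrev C1 : Type (max u v) := ∀ x : G, (Multiplier (P.D x))ˣ

/-- Partial `2`-cochains: families of invertible multipliers of the ideals `D_(x,y)`. -/
abbrev C2 : Type (max u v) := ∀ x y : G, (Multiplier (P.D₂ x y))ˣ

/-- Restriction of invertible multipliers of `A` to an ideal. -/
def resWhole (I : SIdeal A) : (Multiplier A)ˣ →* (Multiplier I)ˣ :=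
  Units.map ((Multiplier.restrict fun a _ => SIdeal.mem_whole a).comp
    (Multiplier.map (SIdeal.wholeEquiv A)))

/-- Restriction of invertible multipliers of an ideal to a smaller ideal. -/
def res {I J : SIdeal A} (h : ∀ a ∈ I, a ∈ J) : (Multiplier J)ˣ →* (Multiplier I)ˣ :=
  Units.map (Multiplier.restrict h)

theorem mul_mul_inv_aux {H : Type u} [CommGroup H] (a a' b b' : H) :
    a * a' * (b * b')⁻¹ = a * b⁻¹ * (a' * b'⁻¹) := by
  rw [mul_inv, mul_mul_mul_comm]

theorem mul_mul_inv_mul_aux {H : Type u} [CommGroup H] (a a' b b' c c' : H) :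
    a * a' * (b * b')⁻¹ * (c * c') = a * b⁻¹ * c * (a' * b'⁻¹ * c') := by
  rw [mul_mul_inv_aux, mul_mul_mul_comm]

/-- `(δ⁰ w)(x) a = θ_x(θ_x⁻¹(a) w) w⁻¹` for `a ∈ D_x`. -/
def δ0 : P.C0 →* P.C1 where
  toFun w x := Units.map (Multiplier.map (P.θ x)) (resWhole (P.D x⁻¹) w) * (resWhole (P.D x) w)⁻¹
  map_one' := by funext x; simp
  map_mul' w w' := by
    funext x
    simp only [map_mul, Pi.mul_apply]
    exact mul_mul_inv_aux (H := (Multiplier (P.D x))ˣ) _ _ _ _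

/-- `(δ¹ w)(x, y) a = θ_x(θ_x⁻¹(a) w(y)) w(xy)⁻¹ w(x)` for `a ∈ D_(x,y)`. -/
def δ1 : P.C1 →* P.C2 where
  toFun w x y :=
    Units.map (Multiplier.map (P.θ₂ x y)) (res SIdeal.inter_le_right (w y)) *
      (res SIdeal.inter_le_right (w (x * y)))⁻¹ * res SIdeal.inter_le_left (w x)
  map_one' := by funext x y; simp
  map_mul' w w' := by
    funext x y
    simp only [map_mul, Pi.mul_apply]
    exact mul_mul_inv_mul_aux (H := (Multiplier (P.D₂ x y))ˣ) _ _ _ _ _ _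

/-- Partial `1`-cocycles. -/
abbrev Z1 : Subgroup P.C1 := P.δ1.ker

/-- Partial `1`-coboundaries. -/
abbrev B1 : Subgroup P.C1 := P.δ0.range

/-- The first partial cohomology group `H¹(G, A) = Z¹(G, A) / B¹(G, A)`; one has `B¹ ≤ Z¹`. -/
abbrev H1 : Type (max u v) := P.Z1 ⧸ P.B1.subgroupOf P.Z1

end PartialAction

/-! ### Extensions and their splittings -/

/-- An extension of a semilattice of groups `A` by a group `G`. -/
structure Extension (A : Type u) (U : Type v) (G : Type w) [InverseSemigroup A]
    [InverseSemigroup U] [Group G] where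
  i : A →ₙ* U
  j : U →ₙ* G
  i_injective : Function.Injective i
  j_surjective : Function.Surjective j
  range_i : Set.range i = {u | j u = 1}

namespace Extension

variable {A : Type u} {U : Type v} {G : Type w} [CommInverseSemigroup A] [InverseSemigroup U]
  [Group G] (E : Extension A U G)

/-- A refinement `A → U → S → G` of an extension `A → U → G`: here `S` is an `E`-unitary inverse
semigroup, `π` and `κ` are epimorphisms, `j = κ ∘ π` and `A → U → S` is an extension of `A` by the
inverse semigroup `S`. -/
structure Refinement (S : Type v) [InverseSemigroup S] where
  π : U →ₙ* S
  κ : S →ₙ* G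
  eUnitary : EUnitary S
  π_surjective : Function.Surjective π
  κ_surjective : Function.Surjective κ
  idem_separating : ∀ e f : U, IsIdempotentElem e → IsIdempotentElem f → π e = π f → e = f
  range_i : Set.range E.i = {u | IsIdempotentElem (π u)}
  j_eq : ∀ u, E.j u = κ (π u)

variable {E} in
/-- `ρ` is an order-preserving transversal of `π`. -/
structure Refinement.IsOrderedTransversal {S : Type v} [InverseSemigroup S] (R : E.Refinement S)
    (ρ : S → U) : Prop where
  π_ρ : ∀ s, R.π (ρ s) = s
  idem : ∀ s, IsIdempotentElem s → IsIdempotentElem (ρ s)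
  mono : ∀ s t, NatLE s t → NatLE (ρ s) (ρ t)

variable {E} in
/-- The partial action induced by a refinement and an order-preserving transversal `ρ` of `π` is
`P`. With `α = i⁻¹ ∘ ρ` on idempotents and `λ_s(a) = i⁻¹(ρ(s) i(a) ρ(s)⁻¹)`, this says that `D_x` is
the union of the components `A_{α(s s⁻¹)}` with `κ(s) = x`, and `θ_x(a) = λ_s(a)` whenever
`κ(s) = x` and `α(s⁻¹ s) = a a⁻¹`. -/
structure Refinement.Induces {S : Type v} [InverseSemigroup S] (R : E.Refinement S)
    (ρ : S → U) (P : PartialAction G A) : Prop where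
  mem_D : ∀ x a, a ∈ P.D x ↔ ∃ s, R.κ s = x ∧ ρ (s * s⁻¹) = E.i (a * a⁻¹)
  θ_eq : ∀ (x : G) (a : P.D x⁻¹) (s : S), R.κ s = x → ρ (s⁻¹ * s) = E.i ((a : A) * (a : A)⁻¹) →
    E.i (P.θ x a) = ρ s * E.i a * (ρ s)⁻¹

/-- The extension is an extension of the partial `G`-module `(A, θ)` by `G`: it is admissible (i.e.
the `π` of a refinement has an order-preserving transversal), and the induced partial `G`-module is
`(A, θ)`. -/
def IsExtensionOf (P : PartialAction G A) : Prop :=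
  ∃ (S : Type v) (_ : InverseSemigroup S) (R : E.Refinement S) (ρ : S → U),
    R.IsOrderedTransversal ρ ∧ R.Induces ρ P

/-- `U(x, e) = {u | j(u) = x, u u⁻¹ = e}`. -/
def fiber (x : G) (e : Idem U) : Set U := {u | E.j u = x ∧ u * u⁻¹ = e}

/-- The idempotent `u e u⁻¹`. -/
def conjIdem (u : U) (e : Idem U) : Idem U := ⟨u * e * u⁻¹, InverseSemigroup.idem_conj u e.2⟩

/-- The idempotent `u⁻¹ e u`. -/
def conjIdem' (u : U) (e : Idem U) : Idem U := ⟨u⁻¹ * e * u, InverseSemigroup.idem_conj' u e.2⟩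

/-- A transversal of `j`: a partial map `τ : G × E(U) ⇀ U` with `τ(x, e)` defined iff
`U(x, e) ≠ ∅`, with `τ(x, e) ∈ U(x, e)` whenever defined, and `τ(1, e) = e`. -/
structure IsTransversal (τ : G × Idem U →. U) : Prop where
  dom_iff : ∀ x e, (τ (x, e)).Dom ↔ (E.fiber x e).Nonempty
  mem_fiber : ∀ x e, ∀ u ∈ τ (x, e), u ∈ E.fiber x e
  one : ∀ e : Idem U, (e : U) ∈ τ (1, e)

/-- A splitting: a transversal with `τ(x, e) τ(y, f) = τ(xy, τ(x, e) f τ(x, e)⁻¹)`, in the sense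
that if the left-hand side is defined then so is the right-hand side and they coincide. -/
structure Splitting where
  τ : G × Idem U →. U
  isTransversal : E.IsTransversal τ
  mul_mem : ∀ (x y : G) (e f : Idem U), ∀ u ∈ τ (x, e), ∀ v ∈ τ (y, f),
    u * v ∈ τ (x * y, conjIdem u f)

/-- The extension splits. -/
def Splits : Prop := Nonempty E.Splitting

/-- The maps `η : E(U) → A` which are order-preserving and satisfy `η(e) ∈ A_{i⁻¹(e)}`. -/
structure IsConjugator (η : Idem U → A) : Prop where
  mono : ∀ e f : Idem U, NatLE (e : U) (f : U) → NatLE (η e) (η f)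
  mem : ∀ e : Idem U, E.i (η e * (η e)⁻¹) = e

variable {E} in
/-- Equivalence of splittings: `τ'(x, e) = i(η(e)) τ(x, e) i(η(τ(x, e)⁻¹ e τ(x, e)))⁻¹`. -/
def Splitting.Equiv (τ τ' : E.Splitting) : Prop :=
  ∃ η : Idem U → A, E.IsConjugator η ∧ ∀ (x : G) (e : Idem U), ∀ u ∈ τ.τ (x, e),
    E.i (η e) * u * (E.i (η (conjIdem' u e)))⁻¹ ∈ τ'.τ (x, e)

theorem exists_preimage (e : Idem U) : ∃ a : A, E.i a = e := by
  have h : E.j e = 1 := by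
    have := congrArg E.j e.2.eq
    rwa [map_mul, mul_eq_left] at this
  have : (e : U) ∈ Set.range E.i := by rw [E.range_i]; exact h
  exact this

section Conjugators

variable {E} {η η' : Idem U → A}

theorem IsConjugator.mul_inv (h : E.IsConjugator η) (e : Idem U) :
    E.i (η e) * (E.i (η e))⁻¹ = e := by
  rw [← InverseSemigroup.map_inv', ← map_mul, h.mem]

theorem IsConjugator.inv_mul (h : E.IsConjugator η) (e : Idem U) :
    (E.i (η e))⁻¹ * E.i (η e) = e := by
  rw [← InverseSemigroup.map_inv', ← map_mul, mul_comm, h.mem]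

theorem IsConjugator.inv (h : E.IsConjugator η) : E.IsConjugator fun e => (η e)⁻¹ where
  mono e f hef := by
    obtain ⟨g, hg, hgf⟩ := h.mono e f hef
    exact ⟨g, hg, by
      rw [hgf, InverseSemigroup.mul_inv_rev', InverseSemigroup.inv_eq_self hg, mul_comm]⟩
  mem e := by rw [InverseSemigroup.inv_inv', mul_comm, h.mem]

theorem IsConjugator.mul (h : E.IsConjugator η) (h' : E.IsConjugator η') :
    E.IsConjugator fun e => η' e * η e where
  mono e f hef := by
    obtain ⟨g, hg, hgf⟩ := h.mono e f hef
    obtain ⟨g', hg', hgf'⟩ := h'.mono e f hef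
    exact ⟨g' * g, InverseSemigroup.idem_mul hg' hg, by rw [hgf, hgf', mul_mul_mul_comm]⟩
  mem e := by
    rw [InverseSemigroup.mul_inv_rev', mul_comm (η e)⁻¹, mul_mul_mul_comm, map_mul, h.mem, h'.mem]
    exact e.2.eq

theorem exists_isConjugator_idem (E : Extension A U G) :
    ∃ η : Idem U → A, E.IsConjugator η ∧ ∀ e, E.i (η e) = e := by
  choose η hη using E.exists_preimage
  have hid : ∀ e, IsIdempotentElem (η e) := fun e => E.i_injective (by
    rw [map_mul, hη]; exact e.2.eq)
  refine ⟨η, ⟨?_, fun e => ?_⟩, hη⟩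
  · rintro e f ⟨g, hg, hgf⟩
    exact ⟨η ⟨g, hg⟩, hid _, E.i_injective (by rw [map_mul, hη, hη, hη, hgf])⟩
  · rw [InverseSemigroup.inv_eq_self (hid e), (hid e).eq, hη]

theorem conjIdem'_of_fiber {x : G} {e : Idem U} {u : U} (hu : u ∈ E.fiber x e) :
    (conjIdem' u e : U) = u⁻¹ * u := by
  change u⁻¹ * e * u = _
  rw [← hu.2, ← mul_assoc, InverseSemigroup.inv_mul_inv_self]

theorem idem_mul_of_fiber {x : G} {e : Idem U} {u : U} (hu : u ∈ E.fiber x e) :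
    (e : U) * u = u := by
  rw [← hu.2, InverseSemigroup.mul_inv_mul_self]

/-- Conjugating an element of `U(x, e)` does not change its domain idempotent. -/
theorem conjIdem'_conj (h : E.IsConjugator η) {x : G} {e : Idem U} {u : U}
    (hu : u ∈ E.fiber x e) :
    conjIdem' (E.i (η e) * u * (E.i (η (conjIdem' u e)))⁻¹) e = conjIdem' u e := by
  apply Subtype.ext
  have h1 := h.inv_mul e
  have h2 := h.mul_inv (conjIdem' u e)
  have h3 : (conjIdem' u e : U) = u⁻¹ * u := conjIdem'_of_fiber hu
  have h4 := idem_mul_of_fiber hu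
  have h5 : (e : U) * e = e := e.2.eq
  set p := E.i (η e)
  set q := E.i (η (conjIdem' u e))
  have hq : q * (conjIdem' u e : U) = q := by
    rw [← h.inv_mul (conjIdem' u e), ← mul_assoc, InverseSemigroup.mul_inv_mul_self]
  have hp : (e : U) * p = p := by
    rw [← h.mul_inv e, InverseSemigroup.mul_inv_mul_self]
  change (p * u * q⁻¹)⁻¹ * e * (p * u * q⁻¹) = _
  calc (p * u * q⁻¹)⁻¹ * e * (p * u * q⁻¹)
      = q * (u⁻¹ * ((p⁻¹ * (e * p)) * u)) * q⁻¹ := by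
        rw [InverseSemigroup.mul_inv_rev', InverseSemigroup.mul_inv_rev',
          InverseSemigroup.inv_inv']
        simp only [mul_assoc]
    _ = q * (conjIdem' u e : U) * q⁻¹ := by rw [hp, h1, h4, h3]
    _ = _ := by rw [hq, h2]

end Conjugators

/-- Equivalence of splittings is an equivalence relation. -/
theorem Splitting.equiv_equivalence : Equivalence (Splitting.Equiv (E := E)) where
  refl τ := by
    obtain ⟨η, h, hη⟩ := E.exists_isConjugator_idem
    refine ⟨η, h, fun x e u hu => ?_⟩
    have hf := τ.isTransversal.mem_fiber x e u hu
    rw [hη, hη, InverseSemigroup.inv_eq_self (conjIdem' u e).2, conjIdem'_of_fiber hf,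
      idem_mul_of_fiber hf, ← mul_assoc, InverseSemigroup.mul_inv_mul_self]
    exact hu
  symm {τ τ'} := by
    rintro ⟨η, h, hη⟩
    refine ⟨_, h.inv, fun x e u' hu' => ?_⟩
    have hne := (τ'.isTransversal.dom_iff x e).1 (Part.dom_iff_mem.2 ⟨u', hu'⟩)
    obtain ⟨u, hu⟩ := Part.dom_iff_mem.1 ((τ.isTransversal.dom_iff x e).2 hne)
    have hf := τ.isTransversal.mem_fiber x e u hu
    obtain rfl := Part.mem_unique hu' (hη x e u hu)
    rw [conjIdem'_conj h hf, InverseSemigroup.map_inv', InverseSemigroup.map_inv',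
      InverseSemigroup.inv_inv']
    have h2 := h.inv_mul (conjIdem' u e)
    have h3 := conjIdem'_of_fiber hf
    have h4 := h.inv_mul e
    have key : (E.i (η e))⁻¹ * (E.i (η e) * u * (E.i (η (conjIdem' u e)))⁻¹) *
        E.i (η (conjIdem' u e)) = u := by
      calc _ = ((E.i (η e))⁻¹ * E.i (η e)) * u *
            ((E.i (η (conjIdem' u e)))⁻¹ * E.i (η (conjIdem' u e))) := by simp only [mul_assoc]
        _ = u := by
          rw [h4, h2, idem_mul_of_fiber hf, h3, ← mul_assoc, InverseSemigroup.mul_inv_mul_self]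
    rw [key]
    exact hu
  trans {τ τ' τ''} := by
    rintro ⟨η, h, hη⟩ ⟨η', h', hη'⟩
    refine ⟨_, h.mul h', fun x e u hu => ?_⟩
    have hf := τ.isTransversal.mem_fiber x e u hu
    have := hη' x e _ (hη x e u hu)
    rw [conjIdem'_conj h hf] at this
    rw [map_mul, map_mul, InverseSemigroup.mul_inv_rev']
    simpa only [mul_assoc] using this

/-- Equivalence of splittings, as a setoid. -/
instance Splitting.setoid : Setoid E.Splitting := ⟨Splitting.Equiv, Splitting.equiv_equivalence E⟩

/-- The equivalence classes of splittings. -/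
abbrev SplittingClass : Type (max v w) := Quotient (Splitting.setoid E)

end Extension

end PartialCohomology

namespace PartialCohomology

universe u v w

/-! ### The natural partial order -/

namespace InverseSemigroup

variable {S : Type u} [InverseSemigroup S]

/-! Splittings form a torsor under 1-cocycles, and conjugation by an order-preserving `η` moves the
cocycle by a coboundary.

It is convenient to index a splitting by elements of `A` instead of idempotents of `U`: the fibre
`U(x, i(a a⁻¹))` is non-empty exactly when `a ∈ D_x`, so a splitting is the same as a family `σ x :
D_x → U` that is compatible with multiplication by idempotents (`IsOrderedSection`) and satisfies
`σ_x(θ_x b) σ_y(b) = σ_xy(θ_x b)` (`IsMultiplicative`). The two directions are `isOrderedSection`,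
`isMultiplicative` and `exists_val_eq`.

Two sections have the same image under `j` and the same range idempotents, so they differ by
elements of `ker j = i(A)`. Compatibility with idempotents says exactly that these elements form an
invertible multiplier of each `D_x`, that is, a 1-cochain `w`. Since `θ_x` is conjugation by any
element of the fibre of `x` (`i_θ`), a coefficient `i(b)` can be moved past `σ_x` at the cost of
`θ_x`; multiplicativity of both sections is then the cocycle identity for `w` (`exists_differ`,
`exists_section`).

Likewise, the conjugators `η` are the invertible multipliers `m` of `A`, restricted to idempotents.
Moving `m` past `σ_x` turns conjugation by `η` into multiplication of the cocycle by `δ⁰ m` or its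
inverse (`equiv_iff`). So the class of `w` depends only on the class of the splitting and determines
it. -/

theorem eq_of_natLE {s t : S} (h : NatLE s t) : s = s * s⁻¹ * t := by
  obtain ⟨e, he, rfl⟩ := h
  rw [mul_inv_rev', inv_eq_self he]
  calc e * t = e * (e * (t * t⁻¹ * t)) := by rw [mul_inv_mul_self, ← mul_assoc, he.eq]
    _ = e * (e * (t * t⁻¹)) * t := by simp only [mul_assoc]
    _ = e * t * (t⁻¹ * e) * t := by rw [idem_comm he (idem_mul_inv t)]; simp only [mul_assoc]

end InverseSemigroup

open InverseSemigroup

/-! ### Invertible multipliers of a semilattice of groups -/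

section Comm

variable {A : Type u} [CommInverseSemigroup A]

theorem mul_mul_inv_self (a : A) : a * (a * a⁻¹) = a := by
  rw [mul_comm, mul_inv_mul_self]

namespace Multiplier

theorem ext_left {m n : Multiplier A} (h : ∀ a, m.left a = n.left a) : m = n := by
  ext a
  · exact h a
  · rw [← left_eq_right, ← left_eq_right, h]

theorem left_mul_mul_inv (m : Multiplier A) (a : A) : m.left a * (a * a⁻¹) = m.left a := by
  rw [← m.left_mul, mul_mul_inv_self]

theorem left_mul_right (m : Multiplier A) (a b : A) : m.left (a * b) = a * m.left b := by
  rw [mul_comm, m.left_mul, mul_comm]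

/-- A multiplier can only move down in the semilattice: the component of `m a` lies below that of
`a`, because `m a` absorbs `a a⁻¹`. -/
theorem left_mul_left_inv (m : Multiplier A) (a : A) :
    m.left a * (m.left a)⁻¹ * (a * a⁻¹) = m.left a * (m.left a)⁻¹ := by
  rw [mul_right_comm, left_mul_mul_inv]

theorem unit_inv_left (m : (Multiplier A)ˣ) (a : A) :
    (m⁻¹ : (Multiplier A)ˣ).val.left (m.val.left a) = a :=
  congrArg (fun n : Multiplier A => n.left a) m.inv_mul

/-- An invertible multiplier preserves the components of a semilattice of groups. -/
theorem unit_left_mul_inv (m : (Multiplier A)ˣ) (a : A) :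
    m.val.left a * (m.val.left a)⁻¹ = a * a⁻¹ := by
  -- Applied to `m⁻¹` at `m a`, the same bound gives the reverse inequality of components.
  have h := left_mul_left_inv (m⁻¹ : (Multiplier A)ˣ).val (m.val.left a)
  rw [unit_inv_left] at h
  rw [← left_mul_left_inv, mul_comm, h]

/-- A compatible choice of elements in the components of `A` acts as an invertible multiplier. -/
theorem exists_unit (c : A → A) (hc : ∀ a b, c (a * b) = c a * (b * b⁻¹))
    (hcc : ∀ a, c a * (c a)⁻¹ = a * a⁻¹) :
    ∃ m : (Multiplier A)ˣ, ∀ a, m.val.left a = c a * a := by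
  have hmul : ∀ a b, c (a * b) * (a * b) = c a * a * b := fun a b => by
    rw [hc, mul_assoc, mul_left_comm (b * b⁻¹), mul_comm (b * b⁻¹), mul_mul_inv_self, mul_assoc]
  have hmul' : ∀ a b, (c (a * b))⁻¹ * (a * b) = (c a)⁻¹ * a * b := fun a b => by
    rw [hc, mul_inv_rev', inv_eq_self (idem_mul_inv b), mul_comm (b * b⁻¹), mul_assoc,
      mul_left_comm (b * b⁻¹), mul_comm (b * b⁻¹), mul_mul_inv_self, mul_assoc]
  let L : ∀ f : A → A, (∀ a b, f (a * b) = f a * b) → Multiplier A := fun f hf =>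
    { left := f
      right := f
      left_mul := hf
      mul_right := fun a b => by rw [mul_comm, hf, mul_comm]
      linked := fun a b => by rw [← hf, mul_comm, ← hf, mul_comm] }
  -- Multiplying `a` by `c a` or `(c a)⁻¹` leaves the value of `c` unchanged, so the translations by
  -- `c a` and by `(c a)⁻¹` undo each other.
  have h1 : ∀ a, c (c a * a) = c a := fun a => by
    rw [mul_comm, hc, mul_mul_inv_self]
  have h2 : ∀ a, c ((c a)⁻¹ * a) = c a := fun a => by
    rw [mul_comm, hc, inv_inv', mul_comm (c a)⁻¹, mul_mul_inv_self]
  refine ⟨⟨L (fun a => c a * a) hmul, L (fun a => (c a)⁻¹ * a) hmul',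
    ext_left fun a => ?_, ext_left fun a => ?_⟩, fun a => rfl⟩
  · change c ((c a)⁻¹ * a) * ((c a)⁻¹ * a) = a
    rw [h2, ← mul_assoc, hcc, mul_inv_mul_self]
  · change (c (c a * a))⁻¹ * (c a * a) = a
    rw [h1, ← mul_assoc, mul_comm _ (c a), hcc, mul_inv_mul_self]

end Multiplier

namespace SIdeal

/-- Ideals of `A` are unions of components, hence invertible multipliers preserve every ideal. -/
theorem mul_inv_mem_iff (I : SIdeal A) (a : A) : a * a⁻¹ ∈ I ↔ a ∈ I :=
  ⟨fun h => by have := I.mul_mem_right _ a h; rwa [mul_inv_mul_self] at this,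
    fun h => I.mul_mem_right _ _ h⟩

end SIdeal

end Comm

/-! ### Cocycles and coboundaries in terms of elements -/

namespace PartialAction

variable {G : Type u} {A : Type v} [Group G] [CommInverseSemigroup A] {P : PartialAction G A}

theorem left_congr (w : P.C1) {x y : G} (h : x = y) (a : P.D x) (b : P.D y) (hab : (a : A) = b) :
    ((w x).val.left a : A) = (w y).val.left b := by
  subst h
  rw [Subtype.ext hab]

theorem θ_mem (x y : G) (b : A) (hx : b ∈ P.D x⁻¹) (hy : b ∈ P.D y) :
    (P.θ x ⟨b, hx⟩ : A) ∈ P.D (x * y) :=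
  (P.θ_mem_D₂ x y ⟨b, hx, hy⟩).2

theorem mul_inv_mul_eq_one_iff {H : Type u} [CommGroup H] (a b c : H) : a * b⁻¹ * c = 1 ↔ c * a = b := by
  rw [mul_right_comm, mul_inv_eq_one, mul_comm]

/-- The cocycle identity `w(x) θ_x(w(y) b) = w(xy) θ_x(b)`. -/
theorem mem_Z1_iff (w : P.C1) : w ∈ P.Z1 ↔
    ∀ (x y : G) (b : A) (hx : b ∈ P.D x⁻¹) (hy : b ∈ P.D y),
      ((w (x * y)).val.left ⟨P.θ x ⟨b, hx⟩, θ_mem x y b hx hy⟩ : A) =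
        (w x).val.left (P.θ x ⟨(w y).val.left ⟨b, hy⟩, (w y).val.left_mem _ ⟨b, hy⟩ hx⟩) := by
  have h0 : w ∈ P.Z1 ↔ ∀ x y, res SIdeal.inter_le_left (w x) *
      Units.map (Multiplier.map (P.θ₂ x y)) (res SIdeal.inter_le_right (w y)) =
        res SIdeal.inter_le_right (w (x * y)) := by
    rw [MonoidHom.mem_ker, funext_iff]
    refine forall_congr' fun x => ?_
    rw [funext_iff]
    refine forall_congr' fun y => ?_
    change _ * _⁻¹ * _ = (1 : (Multiplier (P.D₂ x y))ˣ) ↔ _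
    exact mul_inv_mul_eq_one_iff (H := (Multiplier (P.D₂ x y))ˣ) _ _ _
  rw [h0]
  refine forall_congr' fun x => forall_congr' fun y => ⟨fun h b hx hy => ?_, fun h => ?_⟩
  · have := congrArg (fun m : (Multiplier (P.D₂ x y))ˣ =>
      (m.val.left (P.θ₂ x y ⟨b, hx, hy⟩) : A)) h
    refine this.symm.trans (left_congr w rfl _ _ ?_)
    exact congrArg (fun c => (P.θ₂ x y (((res SIdeal.inter_le_right (w y) :
      (Multiplier ((P.D x⁻¹).inter (P.D y)))ˣ).val.left c)) : A)) ((P.θ₂ x y).symm_apply_apply _)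
  · refine Units.ext (Multiplier.ext_left fun a => Subtype.ext ?_)
    -- Every element of `D_x ∩ D_xy` is `θ_x(b)` with `b ∈ D_{x⁻¹} ∩ D_y`; this substitution removes
    -- `θ_x⁻¹` from the formula for `δ¹`.
    obtain ⟨b, rfl⟩ := (P.θ₂ x y).surjective a
    refine Eq.trans (left_congr w rfl _ _ ?_) (h b b.2.1 b.2.2).symm
    exact congrArg (fun c => (P.θ₂ x y (((res SIdeal.inter_le_right (w y) :
      (Multiplier ((P.D x⁻¹).inter (P.D y)))ˣ).val.left c)) : A)) ((P.θ₂ x y).symm_apply_apply b)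

/-- Two cochains differ by the coboundary of `m` iff `w(x) θ_x(m b) = w'(x) (m θ_x(b))`. -/
theorem δ0_eq_iff (m : P.C0) (w w' : P.C1) : P.δ0 m = w⁻¹ * w' ↔
    ∀ (x : G) (b : P.D x⁻¹),
      (w x).val.left (P.θ x ⟨m.val.left b, by
        rw [← SIdeal.mul_inv_mem_iff, Multiplier.unit_left_mul_inv, SIdeal.mul_inv_mem_iff]
        exact b.2⟩) =
      (w' x).val.left ⟨m.val.left (P.θ x b), by
        rw [← SIdeal.mul_inv_mem_iff, Multiplier.unit_left_mul_inv, SIdeal.mul_inv_mem_iff]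
        exact (P.θ x b).2⟩ := by
  rw [funext_iff]
  refine forall_congr' fun x => ?_
  have h0 : P.δ0 m x = (w⁻¹ * w') x ↔ w x * Units.map (Multiplier.map (P.θ x))
      (resWhole (P.D x⁻¹) m) = w' x * resWhole (P.D x) m := by
    change _ * _⁻¹ = (w x)⁻¹ * w' x ↔ _
    rw [mul_inv_eq_iff_eq_mul, mul_assoc, eq_inv_mul_iff_mul_eq]
  rw [h0]
  refine ⟨fun h b => ?_, fun h => ?_⟩
  · have := congrArg (fun m : (Multiplier (P.D x))ˣ => m.val.left (P.θ x b)) h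
    exact Eq.trans (congrArg (fun c => (w x).val.left (P.θ x
      ((resWhole (P.D x⁻¹) m).val.left c))) ((P.θ x).symm_apply_apply b)).symm this
  · refine Units.ext (Multiplier.ext_left fun a => ?_)
    obtain ⟨b, rfl⟩ := (P.θ x).surjective a
    exact Eq.trans (congrArg (fun c => (w x).val.left (P.θ x
      ((resWhole (P.D x⁻¹) m).val.left c))) ((P.θ x).symm_apply_apply b)) (h b)

end PartialAction

/-! ### Fibres of `j`, and `θ` as conjugation -/

namespace Extension

variable {A : Type u} {U : Type v} {G : Type w} [CommInverseSemigroup A] [InverseSemigroup U]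
  [Group G] {E : Extension A U G} {P : PartialAction G A}

theorem map_inv_j (u : U) : E.j u⁻¹ = (E.j u)⁻¹ := by
  have h := congrArg E.j (mul_inv_mul_self u)
  rw [map_mul, map_mul, mul_eq_right] at h
  exact (inv_eq_of_mul_eq_one_right h).symm

theorem j_i (a : A) : E.j (E.i a) = 1 := by
  have h : E.i a ∈ Set.range E.i := ⟨a, rfl⟩
  rwa [E.range_i] at h

theorem exists_i_eq {u : U} (h : E.j u = 1) : ∃ a, E.i a = u := by
  have h' : u ∈ {u | E.j u = 1} := h
  rwa [← E.range_i] at h'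

theorem i_mul_inv (a : A) : E.i a * (E.i a)⁻¹ = E.i (a * a⁻¹) := by
  rw [map_mul, map_inv']

theorem i_inv_mul (a : A) : (E.i a)⁻¹ * E.i a = E.i (a * a⁻¹) := by
  rw [mul_comm a, map_mul, map_inv']

theorem isIdempotentElem_i {a : A} : IsIdempotentElem (E.i a) ↔ IsIdempotentElem a := by
  unfold IsIdempotentElem
  rw [← map_mul, E.i_injective.eq_iff]

variable (E) in
/-- The idempotent `i(a a⁻¹)` of `U`. -/
def idemOf (a : A) : Idem U := ⟨E.i (a * a⁻¹), isIdempotentElem_i.2 (idem_mul_inv a)⟩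

/-- Elements of a common fibre of `j` with the same range idempotent have the same domain
idempotent. -/
theorem inv_mul_eq_of_mul_inv_eq {u v : U} (hj : E.j u = E.j v) (h : u * u⁻¹ = v * v⁻¹) :
    u⁻¹ * u = v⁻¹ * v := by
  -- The quotient `u⁻¹ v` lies in `i(A)`, where range and domain idempotents agree by commutativity;
  -- for this element they are `u⁻¹ u` and `v⁻¹ v`.
  obtain ⟨b, hb⟩ : ∃ b, E.i b = u⁻¹ * v := exists_i_eq (by rw [map_mul, map_inv_j, hj]; simp)
  have h1 : E.i b * (E.i b)⁻¹ = u⁻¹ * u := by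
    rw [hb, mul_inv_rev', inv_inv']
    calc u⁻¹ * v * (v⁻¹ * u) = u⁻¹ * (v * v⁻¹) * u := by simp only [mul_assoc]
      _ = u⁻¹ * u := by rw [← h, ← mul_assoc, inv_mul_inv_self]
  have h2 : (E.i b)⁻¹ * E.i b = v⁻¹ * v := by
    rw [hb, mul_inv_rev', inv_inv']
    calc v⁻¹ * u * (u⁻¹ * v) = v⁻¹ * (u * u⁻¹) * v := by simp only [mul_assoc]
      _ = v⁻¹ * v := by rw [h, ← mul_assoc, inv_mul_inv_self]
  rw [← h1, ← h2, i_mul_inv, i_inv_mul]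

section Refinement

variable {S : Type v} [InverseSemigroup S] {R : E.Refinement S} {ρ : S → U}

/-- Both sides are idempotents with the same image under `π`, which separates idempotents. The
companion lemmas rest on the same argument. -/
theorem Refinement.IsOrderedTransversal.mul_inv (h : R.IsOrderedTransversal ρ) (s : S) :
    ρ s * (ρ s)⁻¹ = ρ (s * s⁻¹) :=
  R.idem_separating _ _ (idem_mul_inv _) (h.idem _ (idem_mul_inv _))
    (by rw [map_mul, map_inv', h.π_ρ, h.π_ρ])

theorem Refinement.IsOrderedTransversal.inv_mul (h : R.IsOrderedTransversal ρ) (s : S) :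
    (ρ s)⁻¹ * ρ s = ρ (s⁻¹ * s) :=
  R.idem_separating _ _ (idem_inv_mul _) (h.idem _ (idem_inv_mul _))
    (by rw [map_mul, map_inv', h.π_ρ, h.π_ρ])

theorem Refinement.IsOrderedTransversal.map_π_mul_inv (h : R.IsOrderedTransversal ρ) (u : U) :
    ρ (R.π u * (R.π u)⁻¹) = u * u⁻¹ :=
  R.idem_separating _ _ (h.idem _ (idem_mul_inv _)) (idem_mul_inv _)
    (by rw [map_mul, map_inv', h.π_ρ])

theorem Refinement.IsOrderedTransversal.map_π_inv_mul (h : R.IsOrderedTransversal ρ) (u : U) :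
    ρ ((R.π u)⁻¹ * R.π u) = u⁻¹ * u :=
  R.idem_separating _ _ (h.idem _ (idem_inv_mul _)) (idem_inv_mul _)
    (by rw [map_mul, map_inv', h.π_ρ])

end Refinement

/-- `D_x` consists of the components of `A` over which the fibre of `x` is non-empty. -/
theorem IsExtensionOf.fiber_nonempty_iff (hE : E.IsExtensionOf P) (x : G) (a : A) (e : Idem U)
    (he : E.i (a * a⁻¹) = e) : (E.fiber x e).Nonempty ↔ a ∈ P.D x := by
  obtain ⟨S, _, R, ρ, hρ, hI⟩ := hE
  rw [hI.mem_D, he]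
  constructor
  · rintro ⟨u, hu, hue⟩
    exact ⟨R.π u, by rw [← R.j_eq, hu], by rw [hρ.map_π_mul_inv, hue]⟩
  · rintro ⟨s, hs, hse⟩
    exact ⟨ρ s, by rw [R.j_eq, hρ.π_ρ, hs], by rw [hρ.mul_inv, hse]⟩

/-- `θ_x` is conjugation by any element of the fibre of `x` with the right domain. -/
theorem IsExtensionOf.i_θ (hE : E.IsExtensionOf P) {x : G} (b : P.D x⁻¹) {u : U}
    (hu : E.j u = x) (hub : u⁻¹ * u = E.i ((b : A) * (b : A)⁻¹)) :
    E.i (P.θ x b) = u * E.i b * u⁻¹ := by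
  obtain ⟨S, _, R, ρ, hρ, hI⟩ := hE
  set r := ρ (R.π u) with hr
  have h1 : E.i (P.θ x b) = r * E.i b * r⁻¹ :=
    hI.θ_eq x b (R.π u) (by rw [← R.j_eq, hu]) (by rw [hρ.map_π_inv_mul, hub])
  have h2 : r⁻¹ * r = u⁻¹ * u := by rw [hρ.inv_mul, hρ.map_π_inv_mul]
  have hj : E.j r = x := by rw [R.j_eq, hρ.π_ρ, ← R.j_eq, hu]
  -- The element `u` differs from the transversal value `r` by a factor `i(c)`. Conjugation by
  -- `i(c)` is trivial on the relevant component because `A` is commutative, so `r` may be replaced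
  -- by `u`.
  obtain ⟨c, hc⟩ : ∃ c, E.i c = u * r⁻¹ := exists_i_eq (by rw [map_mul, map_inv_j, hj, hu]; simp)
  have h3 : u = E.i c * r := by
    rw [hc, mul_assoc, h2, ← mul_assoc, mul_inv_mul_self]
  have h4 : E.i (c * c⁻¹) = u * u⁻¹ := by
    rw [← i_mul_inv, hc, mul_inv_rev', inv_inv']
    calc u * r⁻¹ * (r * u⁻¹) = u * (r⁻¹ * r) * u⁻¹ := by simp only [mul_assoc]
      _ = _ := by rw [h2, ← mul_assoc, mul_inv_mul_self]
  have h5 : r * r⁻¹ = u * u⁻¹ := by rw [hρ.mul_inv, hρ.map_π_mul_inv]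
  calc E.i (P.θ x b) = r * r⁻¹ * E.i (P.θ x b) := by
        rw [h1]; simp only [← mul_assoc]; rw [mul_inv_mul_self]
    _ = E.i (c * P.θ x b * c⁻¹) := by
        rw [h5, ← h4, ← map_mul, mul_right_comm]
    _ = u * E.i b * u⁻¹ := by
        rw [map_mul, map_mul, h1, map_inv', h3, mul_inv_rev']
        simp only [mul_assoc]

/-- The element `u⁻¹` witnesses that the fibre of `x⁻¹` over `u⁻¹ u` is non-empty. -/
theorem IsExtensionOf.inv_mem_D (hE : E.IsExtensionOf P) {x : G} {u : U} (hu : E.j u = x) {h : A}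
    (hh : IsIdempotentElem h) (hi : E.i h = u⁻¹ * u) : h ∈ P.D x⁻¹ := by
  refine (hE.fiber_nonempty_iff x⁻¹ h ⟨_, idem_inv_mul u⟩ ?_).1 ⟨u⁻¹, ?_, ?_⟩
  · rw [inv_eq_self hh, hh.eq, hi]
  · rw [map_inv_j, hu]
  · rw [inv_inv']

/-- Conjugation by `u` takes its domain idempotent to its range idempotent, so `θ_x` takes `i⁻¹(u⁻¹
u)` to `θ_x(b b⁻¹)`, and `θ_x` is injective. This supplies the domain condition of `i_θ` from data
about the range. -/
theorem IsExtensionOf.inv_mul_of_mul_inv (hE : E.IsExtensionOf P) {x : G} (b : P.D x⁻¹) {u : U}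
    (hu : E.j u = x) (hub : u * u⁻¹ = E.i ((P.θ x b : A) * (P.θ x b : A)⁻¹)) :
    u⁻¹ * u = E.i ((b : A) * (b : A)⁻¹) := by
  obtain ⟨h, hh⟩ := E.exists_preimage ⟨_, idem_inv_mul u⟩
  change E.i h = u⁻¹ * u at hh
  have hid : IsIdempotentElem h := isIdempotentElem_i.1 (hh ▸ idem_inv_mul u)
  have hmem := hE.inv_mem_D hu hid hh
  have key := hE.i_θ ⟨h, hmem⟩ hu (by rw [inv_eq_self hid, hid.eq, hh])
  change _ = u * E.i h * u⁻¹ at key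
  rw [hh, ← mul_assoc, mul_inv_mul_self, hub] at key
  have := E.i_injective key
  have h2 : P.θ x ⟨h, hmem⟩ = P.θ x (b * b⁻¹) := by
    apply Subtype.ext
    rw [this, map_mul]
    have h3 : P.θ x b⁻¹ = (P.θ x b)⁻¹ := map_inv' (P.θ x).toMulHom b
    rw [h3]
    rfl
  rw [← hh]
  exact congrArg (fun c : P.D x⁻¹ => E.i c) ((P.θ x).injective h2)

end Extension

theorem mul_mul_mul_inv {A : Type u} [CommInverseSemigroup A] (b a : A) :
    b * a * (b * a)⁻¹ = (b * b⁻¹) * (a * a⁻¹) := by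
  rw [mul_inv_rev', mul_comm a⁻¹, mul_mul_mul_comm]

/-- The multiplicativity of a splitting, in terms of sections. -/
def PartialAction.IsMultiplicative {A : Type u} {U : Type v} {G : Type w}
    [CommInverseSemigroup A] [Mul U] [Group G] (P : PartialAction G A) (σ : ∀ x, P.D x → U) : Prop :=
  ∀ (x y : G) (b : A) (hx : b ∈ P.D x⁻¹) (hy : b ∈ P.D y),
    σ x (P.θ x ⟨b, hx⟩) * σ y ⟨b, hy⟩ = σ (x * y) ⟨P.θ x ⟨b, hx⟩, P.θ_mem x y b hx hy⟩

/-! ### Sections over the ideals `D_x` -/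

namespace Extension

variable {A : Type u} {U : Type v} {G : Type w} [CommInverseSemigroup A] [InverseSemigroup U]
  [Group G] {E : Extension A U G} {P : PartialAction G A}

/-- The intertwining form of conjugation, by which coefficients from `A` are moved past `u`. -/
theorem IsExtensionOf.i_θ_mul (hE : E.IsExtensionOf P) {x : G} (b : P.D x⁻¹) {u : U}
    (hu : E.j u = x) (hub : u * u⁻¹ = E.i ((P.θ x b : A) * (P.θ x b : A)⁻¹)) :
    E.i (P.θ x b) * u = u * E.i b := by
  have h := hE.inv_mul_of_mul_inv b hu hub
  rw [hE.i_θ b hu h, mul_assoc, h, mul_assoc, ← map_mul, mul_mul_inv_self]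

variable (E P) in
/-- A section of the fibres `U(x, i(a a⁻¹))` with `a ∈ D_x`, compatible with the action of the
idempotents. -/
structure IsOrderedSection (σ : ∀ x, P.D x → U) : Prop where
  j_eq : ∀ x a, E.j (σ x a) = x
  mul_inv : ∀ x a, σ x a * (σ x a)⁻¹ = E.i ((a : A) * (a : A)⁻¹)
  smul : ∀ x (a : P.D x) (b : A) (h : b * a ∈ P.D x),
    σ x ⟨b * a, h⟩ = E.i (b * b⁻¹) * σ x a

namespace IsOrderedSection

variable {σ σ₀ : ∀ x, P.D x → U}

/-- A section sees only the component of its argument: within one component `a = (a b⁻¹) b`, and the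
factor `a b⁻¹` acts through its idempotent, which `σ b` absorbs. -/
theorem congr (hσ : E.IsOrderedSection P σ) {x y : G} (h : x = y) (a : P.D x) (b : P.D y)
    (hab : (a : A) * (a : A)⁻¹ = (b : A) * (b : A)⁻¹) : σ x a = σ y b := by
  subst h
  have h1 : (a : A) = (a * (b : A)⁻¹) * b := by
    rw [mul_assoc, mul_comm _ (b : A), ← hab, mul_mul_inv_self]
  have h2 : (a * (b : A)⁻¹ : A) * (a * (b : A)⁻¹ : A)⁻¹ = b * (b : A)⁻¹ := by
    rw [mul_inv_rev', inv_inv', mul_comm (b : A), mul_mul_mul_comm, hab, mul_comm _ (b : A)]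
    exact idem_mul_inv (b : A)
  calc σ x a = σ x ⟨(a * (b : A)⁻¹) * b, h1 ▸ a.2⟩ := congrArg (σ x) (Subtype.ext h1)
    _ = σ x b := by rw [hσ.smul, h2, ← hσ.mul_inv, mul_inv_mul_self]

theorem i_mul_section (hσ : E.IsOrderedSection P σ) (x : G) (a : P.D x) :
    E.i ((a : A) * (a : A)⁻¹) * σ x a = σ x a := by
  rw [← hσ.mul_inv, mul_inv_mul_self]

theorem inv_mul_eq (hσ₀ : E.IsOrderedSection P σ₀) (hσ : E.IsOrderedSection P σ) (x : G)
    (a : P.D x) : (σ₀ x a)⁻¹ * σ₀ x a = (σ x a)⁻¹ * σ x a :=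
  inv_mul_eq_of_mul_inv_eq (by rw [hσ₀.j_eq, hσ.j_eq]) (by rw [hσ₀.mul_inv, hσ.mul_inv])

/-- Elements of a component of `A` can be cancelled against a section. -/
theorem cancel (hσ : E.IsOrderedSection P σ) {x : G} {a : P.D x} {b c : A}
    (hb : b * b⁻¹ = (a : A) * (a : A)⁻¹) (hc : c * c⁻¹ = (a : A) * (a : A)⁻¹)
    (h : E.i b * σ x a = E.i c * σ x a) : b = c := by
  have h1 := congrArg (· * (σ x a)⁻¹) h
  simp only [mul_assoc, hσ.mul_inv] at h1
  rw [← map_mul, ← map_mul, ← hb, mul_mul_inv_self, hb, ← hc, mul_mul_inv_self] at h1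
  exact E.i_injective h1

theorem i_θ_mul (hE : E.IsExtensionOf P) (hσ : E.IsOrderedSection P σ) (x : G) (b : P.D x⁻¹) :
    E.i (P.θ x b) * σ x (P.θ x b) = σ x (P.θ x b) * E.i b :=
  hE.i_θ_mul b (hσ.j_eq _ _) (hσ.mul_inv _ _)

end IsOrderedSection

theorem left_mul_inv (w : P.C1) (x : G) (a : P.D x) :
    ((w x).val.left a : A) * ((w x).val.left a : A)⁻¹ = (a : A) * (a : A)⁻¹ :=
  congrArg Subtype.val (Multiplier.unit_left_mul_inv (w x) a)

theorem θ_mul_inv (x : G) {a b : P.D x⁻¹} (h : (a : A) * (a : A)⁻¹ = (b : A) * (b : A)⁻¹) :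
    (P.θ x a : A) * (P.θ x a : A)⁻¹ = (P.θ x b : A) * (P.θ x b : A)⁻¹ := by
  have h' : a * a⁻¹ = b * b⁻¹ := Subtype.ext h
  have hi : ∀ c, P.θ x c⁻¹ = (P.θ x c)⁻¹ := map_inv' (P.θ x).toMulHom
  have h2 := congrArg (P.θ x) h'
  rw [map_mul, map_mul, hi, hi] at h2
  exact congrArg Subtype.val h2

variable (E P) in
/-- The section `σ` is obtained from `σ₀` by multiplication with the cochain `w`. -/
def Differ (σ₀ σ : ∀ x, P.D x → U) (w : P.C1) : Prop :=
  ∀ x (a : P.D x), E.i ((w x).val.left a) * σ₀ x a = E.i a * σ x a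

variable {σ σ₀ : ∀ x, P.D x → U}

/-- Replaces both factors by `σ₀`, moving `w(y) b` past the first one by `i_θ_mul`. The resulting
coefficient is one side of the cocycle identity in `mem_Z1_iff`, so the formula serves both to
derive that identity and to use it. -/
theorem Differ.mul_eq (hE : E.IsExtensionOf P) {w : P.C1} (h : E.Differ P σ₀ σ w)
    (hσ₀ : E.IsOrderedSection P σ₀) (hσ : E.IsOrderedSection P σ) (hm : P.IsMultiplicative σ₀)
    (x y : G) (b : A) (hx : b ∈ P.D x⁻¹) (hy : b ∈ P.D y) :
    E.i (P.θ x ⟨b, hx⟩) * (σ x (P.θ x ⟨b, hx⟩) * σ y ⟨b, hy⟩) =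
      E.i ((w x).val.left (P.θ x ⟨(w y).val.left ⟨b, hy⟩, (w y).val.left_mem _ ⟨b, hy⟩ hx⟩)) *
        σ₀ (x * y) ⟨P.θ x ⟨b, hx⟩, P.θ_mem x y b hx hy⟩ := by
  set b' : P.D x⁻¹ := ⟨(w y).val.left ⟨b, hy⟩, (w y).val.left_mem _ ⟨b, hy⟩ hx⟩
  have hb : (P.θ x b' : A) * (P.θ x b' : A)⁻¹ =
    (P.θ x ⟨b, hx⟩ : A) * (P.θ x ⟨b, hx⟩ : A)⁻¹ := θ_mul_inv x (left_mul_inv w y ⟨b, hy⟩)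
  have h1 : σ x (P.θ x b') = σ x (P.θ x ⟨b, hx⟩) := hσ.congr rfl _ _ hb
  have h2 : σ₀ x (P.θ x b') = σ₀ x (P.θ x ⟨b, hx⟩) := hσ₀.congr rfl _ _ hb
  have h3 := h x (P.θ x b')
  have h4 := hσ.i_θ_mul hE x b'
  rw [h1] at h4 h3
  rw [h2] at h3
  rw [← hm x y b hx hy, ← mul_assoc, ← mul_assoc, h3, hσ.i_θ_mul hE, h4, mul_assoc, mul_assoc]
  exact congrArg _ (h y ⟨b, hy⟩).symm

/-- Two sections coming from splittings differ by a cocycle. -/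
theorem exists_differ (hE : E.IsExtensionOf P)
    (hσ₀ : E.IsOrderedSection P σ₀) (hσ : E.IsOrderedSection P σ) (hm₀ : P.IsMultiplicative σ₀)
    (hm : P.IsMultiplicative σ) : ∃ w ∈ P.Z1, E.Differ P σ₀ σ w := by
  -- The cochain is the quotient of the two sections, which lies in `ker j`.
  have hex : ∀ x (a : P.D x), ∃ c, E.i c = σ x a * (σ₀ x a)⁻¹ := fun x a =>
    exists_i_eq (by rw [map_mul, map_inv_j, hσ.j_eq, hσ₀.j_eq]; simp)
  choose c hc using hex
  have hcc : ∀ x a, c x a * (c x a)⁻¹ = (a : A) * (a : A)⁻¹ := fun x a => E.i_injective (by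
    rw [map_mul, map_inv', hc, mul_inv_rev', inv_inv']
    calc σ x a * (σ₀ x a)⁻¹ * (σ₀ x a * (σ x a)⁻¹)
        = σ x a * ((σ₀ x a)⁻¹ * σ₀ x a) * (σ x a)⁻¹ := by simp only [mul_assoc]
      _ = _ := by rw [hσ₀.inv_mul_eq hσ, ← mul_assoc, mul_inv_mul_self, hσ.mul_inv])
  have hcmem : ∀ x a, c x a ∈ P.D x := fun x a => by
    rw [← SIdeal.mul_inv_mem_iff, hcc, SIdeal.mul_inv_mem_iff]; exact a.2
  have hcs : ∀ x (a b : P.D x), c x (a * b) = c x a * (b * (b : A)⁻¹) := fun x a b => by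
    have hab : a * b = ⟨b * a, (P.D x).mul_mem_left _ _ a.2⟩ := Subtype.ext (mul_comm _ _)
    apply E.i_injective
    rw [hab, hc, hσ.smul, hσ₀.smul, mul_inv_rev',
      inv_eq_self (isIdempotentElem_i.2 (idem_mul_inv (b : A))), mul_assoc, ← mul_assoc (σ x a),
      ← hc, ← map_mul, ← map_mul, mul_comm, mul_assoc, (idem_mul_inv (b : A)).eq]
  choose w hw using fun x => Multiplier.exists_unit (fun a : P.D x => ⟨c x a, hcmem x a⟩)
    (fun a b => Subtype.ext (hcs x a b)) (fun a => Subtype.ext (hcc x a))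
  have hd : E.Differ P σ₀ σ w := fun x a => by
    have : ((w x).val.left a : A) = a * c x a := by rw [hw]; exact mul_comm _ _
    rw [this, map_mul, hc, mul_assoc, mul_assoc, hσ₀.inv_mul_eq hσ, ← mul_assoc (σ x a),
      mul_inv_mul_self]
  refine ⟨w, (P.mem_Z1_iff w).2 fun x y b hx hy => ?_, hd⟩
  -- As `σ` is multiplicative too, this and `hd` at `x * y` express one element through `σ₀ (x * y)`
  -- with two coefficients in the same component; cancelling gives the cocycle identity.
  have h := hd.mul_eq hE hσ₀ hσ hm₀ x y b hx hy
  rw [hm] at h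
  refine hσ₀.cancel (left_mul_inv w _ _) ?_ ((hd _ _).trans h)
  exact (left_mul_inv w _ _).trans (θ_mul_inv x (left_mul_inv w y ⟨b, hy⟩))

/-- Multiplication by a cocycle turns the section of a splitting into another one. -/
theorem exists_section (hE : E.IsExtensionOf P) (hσ₀ : E.IsOrderedSection P σ₀)
    (hm₀ : P.IsMultiplicative σ₀) {w : P.C1} (hw : w ∈ P.Z1) :
    ∃ σ, E.IsOrderedSection P σ ∧ P.IsMultiplicative σ ∧ E.Differ P σ₀ σ w := by
  -- The multiplier is evaluated at `a a⁻¹`, not at `a`, so that the result depends only on the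
  -- component of `a`.
  let σ : ∀ x, P.D x → U := fun x a => E.i ((w x).val.left (a * a⁻¹)) * σ₀ x a
  have hd : E.Differ P σ₀ σ w := fun x a => by
    change _ = E.i a * (E.i ((w x).val.left (a * a⁻¹)) * σ₀ x a)
    rw [← mul_assoc, ← map_mul]
    have h : (w x).val.left a = a * (w x).val.left (a * a⁻¹) := by
      rw [← Multiplier.left_mul_right, mul_mul_inv_self]
    rw [congrArg Subtype.val h]
    rfl
  have hw1 : ∀ x (a : P.D x), ((w x).val.left (a * a⁻¹) : A) * ((w x).val.left (a * a⁻¹) : A)⁻¹ =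
      (a : A) * (a : A)⁻¹ := fun x a => by
    rw [left_mul_inv]
    change ((a : A) * (a : A)⁻¹) * ((a : A) * (a : A)⁻¹)⁻¹ = _
    rw [inv_eq_self (idem_mul_inv _), (idem_mul_inv _).eq]
  have hσ : E.IsOrderedSection P σ :=
    { j_eq := fun x a => by rw [map_mul, j_i, one_mul, hσ₀.j_eq]
      mul_inv := fun x a => by
        change E.i _ * σ₀ x a * (E.i _ * σ₀ x a)⁻¹ = _
        rw [mul_inv_rev', mul_assoc, ← mul_assoc (σ₀ x a), hσ₀.mul_inv, ← map_inv', ← map_mul,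
          ← map_mul, mul_left_comm, hw1]
        exact congrArg E.i (idem_mul_inv (a : A))
      smul := fun x a b h => by
        change E.i _ * σ₀ x _ = _ * (E.i _ * σ₀ x a)
        rw [hσ₀.smul, ← mul_assoc, ← mul_assoc, ← map_mul, ← map_mul]
        have h1 : (⟨b * a, h⟩ : P.D x) * ⟨b * a, h⟩⁻¹ = (⟨b * a, h⟩ * ⟨b * a, h⟩⁻¹) * (a * a⁻¹) := by
          apply Subtype.ext
          change (b * (a : A)) * (b * (a : A))⁻¹ = (b * (a : A)) * (b * (a : A))⁻¹ * (a * (a : A)⁻¹)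
          rw [mul_mul_mul_inv, mul_assoc (b * b⁻¹), (idem_mul_inv (a : A)).eq]
        have h2 : ((w x).val.left (⟨b * a, h⟩ * ⟨b * a, h⟩⁻¹) : A) =
            (b * b⁻¹) * (w x).val.left (a * a⁻¹) := by
          rw [h1, Multiplier.left_mul_right]
          change (b * (a : A)) * (b * (a : A))⁻¹ * ((w x).val.left (a * a⁻¹) : A) = _
          rw [mul_mul_mul_inv, mul_assoc (b * b⁻¹), ← hw1 x a,
            mul_inv_mul_self]
        rw [h2, mul_right_comm, (idem_mul_inv b).eq] }
  refine ⟨σ, hσ, fun x y b hx hy => ?_, hd⟩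
  have h := hd.mul_eq hE hσ₀ hσ hm₀ x y b hx hy
  rw [← (P.mem_Z1_iff w).1 hw x y b hx hy, hd] at h
  set a := P.θ x ⟨b, hx⟩
  -- Both sides of `h` carry a factor `i(a)`; multiplying by `i(a⁻¹)` turns it into an idempotent
  -- that the sections absorb.
  have h' := congrArg (E.i ((a : A)⁻¹) * ·) h
  simp only [← mul_assoc] at h'
  rw [← map_mul, mul_comm _ (a : A), hσ.i_mul_section] at h'
  exact h'.trans (hσ.i_mul_section (x * y) ⟨a, _⟩)

/-! ### From multiplicative sections to splittings -/

namespace IsOrderedSection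

/-- With `x = y = 1` and `θ_1 = id`, multiplicativity makes `σ 1 a` idempotent, hence equal to its
range idempotent. -/
theorem eq_of_one (hσ : E.IsOrderedSection P σ) (hm : P.IsMultiplicative σ) (a : P.D 1) :
    σ 1 a = E.i ((a : A) * (a : A)⁻¹) := by
  have h1 : (a : A) ∈ P.D 1⁻¹ := by rw [inv_one]; exact a.2
  have h := hm 1 1 a h1 a.2
  rw [hσ.congr rfl _ a (by rw [P.θ_one]), hσ.congr (mul_one 1) _ a (by simp only [P.θ_one])] at h
  have hid : IsIdempotentElem (σ 1 a) := h
  rw [← hσ.mul_inv, inv_eq_self hid, hid.eq]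

theorem fiber_mem (hσ : E.IsOrderedSection P σ) {x : G} {a : P.D x} {e : Idem U}
    (h : E.i a = e) : σ x a ∈ E.fiber x e := by
  refine ⟨hσ.j_eq _ _, ?_⟩
  have hid : IsIdempotentElem (a : A) := isIdempotentElem_i.1 (h ▸ e.2)
  rw [hσ.mul_inv, inv_eq_self hid, hid.eq, h]

/-- A multiplicative section defines a splitting. -/
theorem exists_splitting (hE : E.IsExtensionOf P) (hσ : E.IsOrderedSection P σ)
    (hm : P.IsMultiplicative σ) :
    ∃ τ : E.Splitting, ∀ x (a : P.D x) (e : Idem U), E.i a = e → σ x a ∈ τ.τ (x, e) := by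
  -- The preimage of the idempotent under `i` is unique, so the choice is harmless.
  let τ : G × Idem U →. U := fun p =>
    ⟨∃ a : P.D p.1, E.i a = p.2, fun h => σ p.1 h.choose⟩
  have hτ : ∀ x (a : P.D x) (e : Idem U), E.i a = e → σ x a ∈ τ (x, e) := fun x a e h => by
    have hex : ∃ a : P.D x, E.i a = e := ⟨a, h⟩
    refine ⟨hex, ?_⟩
    have : hex.choose = a := Subtype.ext (E.i_injective (by rw [hex.choose_spec, h]))
    exact congrArg (σ x) this
  have hτ' : ∀ x e, ∀ u ∈ τ (x, e), ∃ a : P.D x, E.i a = e ∧ σ x a = u := by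
    rintro x e u ⟨h, hu⟩
    exact ⟨h.choose, h.choose_spec, hu⟩
  refine ⟨⟨τ, ⟨fun x e => ?_, ?_, fun e => ?_⟩, ?_⟩, hτ⟩
  · obtain ⟨a, ha⟩ := E.exists_preimage e
    have hid : IsIdempotentElem a := isIdempotentElem_i.1 (ha ▸ e.2)
    rw [hE.fiber_nonempty_iff x a e (by rw [inv_eq_self hid, hid.eq, ha])]
    exact ⟨fun ⟨b, hb⟩ => E.i_injective (hb.trans ha.symm) ▸ b.2, fun h => ⟨⟨a, h⟩, ha⟩⟩
  · intro x e u hu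
    obtain ⟨a, ha, rfl⟩ := hτ' x e u hu
    exact hσ.fiber_mem ha
  · obtain ⟨a, ha⟩ := E.exists_preimage e
    have hid : IsIdempotentElem a := isIdempotentElem_i.1 (ha ▸ e.2)
    have h := hτ 1 ⟨a, P.D_one a⟩ e ha
    rwa [hσ.eq_of_one hm, inv_eq_self hid, hid.eq, ha] at h
  · intro x y e f u hu v hv
    obtain ⟨a, ha, rfl⟩ := hτ' x e u hu
    obtain ⟨b, hb, rfl⟩ := hτ' y f v hv
    -- Multiplicativity of `σ` covers only factors whose idempotents match. For arbitrary `u = σ x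
    -- a` and `v = σ y b`, with `i(h) = u⁻¹ u`, the product is rewritten as `u v = (u i(b)) (i(h)
    -- v)`; these factors are the sections at `θ_x(h b)` and at `h b`.
    obtain ⟨h, hh⟩ := E.exists_preimage ⟨_, idem_inv_mul (σ x a)⟩
    change E.i h = (σ x a)⁻¹ * σ x a at hh
    have hid : IsIdempotentElem h := isIdempotentElem_i.1 (hh ▸ idem_inv_mul (σ x a))
    have hbid : IsIdempotentElem (b : A) := isIdempotentElem_i.1 (hb ▸ f.2)
    have hhb : h * b ∈ P.D x⁻¹ :=
      (P.D x⁻¹).mul_mem_right _ _ (hE.inv_mem_D (hσ.j_eq x a) hid hh)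
    have hhb' : h * b ∈ P.D y := (P.D y).mul_mem_left _ _ b.2
    have hhbid : IsIdempotentElem (h * b) := idem_mul hid hbid
    have hub : σ x a * E.i (h * b) = σ x a * E.i b := by
      rw [map_mul, hh, ← mul_assoc, ← mul_assoc, mul_inv_mul_self]
    -- Conjugation is done by `u i(b)` instead of `u`, since its domain idempotent is exactly `i(h
    -- b)`.
    have hg : E.i (P.θ x ⟨h * b, hhb⟩) = σ x a * E.i b * (σ x a)⁻¹ := by
      rw [hE.i_θ ⟨h * b, hhb⟩ (u := σ x a * E.i b)]
      · rw [mul_inv_rev', ← map_inv', inv_eq_self hbid]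
        calc σ x a * E.i b * E.i (h * b) * (E.i b * (σ x a)⁻¹)
            = σ x a * (E.i b * E.i (h * b) * E.i b) * (σ x a)⁻¹ := by simp only [mul_assoc]
          _ = σ x a * E.i (h * b) * (σ x a)⁻¹ := by
            rw [← map_mul, ← map_mul, mul_comm (b : A), mul_assoc h, hbid.eq, mul_assoc h, hbid.eq]
          _ = _ := by rw [hub]
      · rw [map_mul, hσ.j_eq, j_i, mul_one]
      · rw [mul_inv_rev', ← map_inv', inv_eq_self hbid, mul_assoc, ← mul_assoc (σ x a)⁻¹, ← hh,
          ← map_mul, ← map_mul, inv_eq_self hhbid, hhbid.eq, mul_left_comm, hbid.eq]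
    have key := hm x y (h * b) hhb hhb'
    have h1 : σ x (P.θ x ⟨h * b, hhb⟩) = σ x a * E.i b := by
      set g := P.θ x ⟨h * b, hhb⟩
      have hgid : IsIdempotentElem (g : A) :=
        isIdempotentElem_i.1 (hg ▸ idem_conj _ (isIdempotentElem_i.2 hbid))
      have hga : (g : A) * a = g := by
        apply E.i_injective
        have haid : IsIdempotentElem (a : A) := isIdempotentElem_i.1 (ha ▸ e.2)
        have h5 := hσ.mul_inv x a
        rw [inv_eq_self haid, haid.eq] at h5
        rw [mul_comm, map_mul, hg, ← h5]
        simp only [← mul_assoc]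
        rw [mul_inv_mul_self]
      have h3 : σ x g = E.i g * σ x a := by
        have := hσ.smul x a g (hga.symm ▸ g.2)
        rw [inv_eq_self hgid, hgid.eq] at this
        rw [← this]
        exact congrArg (σ x) (Subtype.ext hga.symm)
      rw [h3, hg, mul_assoc, ← hh, mul_assoc, ← map_mul, mul_comm, hub]
    have h2 : σ y ⟨h * b, hhb'⟩ = E.i h * σ y b := by
      rw [hσ.smul, inv_eq_self hid, hid.eq]
    have h4 : σ x a * E.i b * (E.i h * σ y b) = σ x a * σ y b := by
      rw [mul_assoc, ← mul_assoc (E.i b), ← map_mul, mul_comm (b : A), ← mul_assoc, hub, mul_assoc]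
      congr 1
      have := hσ.i_mul_section y b
      rwa [inv_eq_self hbid, hbid.eq] at this
    rw [h1, h2, h4] at key
    rw [key]
    refine hτ _ _ _ ?_
    change E.i (P.θ x ⟨h * b, hhb⟩) = σ x a * f * (σ x a)⁻¹
    rw [hg, hb]

end IsOrderedSection

/-! ### From splittings to multiplicative sections -/

namespace Splitting

/-- The section of a splitting. -/
noncomputable def val (hE : E.IsExtensionOf P) (τ : E.Splitting) (x : G) (a : P.D x) : U :=
  (τ.τ (x, E.idemOf (a : A))).get
    ((τ.isTransversal.dom_iff _ _).2 ((hE.fiber_nonempty_iff x a _ rfl).2 a.2))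

theorem val_mem_idemOf (hE : E.IsExtensionOf P) (τ : E.Splitting) (x : G) (a : P.D x) :
    τ.val hE x a ∈ τ.τ (x, E.idemOf (a : A)) := Part.get_mem _

theorem idemOf_eq {a : A} {e : Idem U} (h : E.i a = e) : E.idemOf a = e := by
  have hid : IsIdempotentElem a := isIdempotentElem_i.1 (h ▸ e.2)
  apply Subtype.ext
  change E.i (a * a⁻¹) = e
  rw [inv_eq_self hid, hid.eq, h]

theorem eq_val (hE : E.IsExtensionOf P) (τ : E.Splitting) {x : G} {a : P.D x} {e : Idem U}
    (h : E.i ((a : A) * (a : A)⁻¹) = e) {u : U} (hu : u ∈ τ.τ (x, e)) : u = τ.val hE x a := by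
  obtain rfl : E.idemOf (a : A) = e := Subtype.ext h
  exact Part.mem_unique hu (τ.val_mem_idemOf hE x a)

/-- Compatibility with idempotents is the product rule with first argument `1`: since `τ(1, e) = e`,
it reads `e τ(x, f) = τ(x, e f)`. -/
theorem isOrderedSection (hE : E.IsExtensionOf P) (τ : E.Splitting) :
    E.IsOrderedSection P (τ.val hE) where
  j_eq x a := (τ.isTransversal.mem_fiber _ _ _ (τ.val_mem_idemOf hE x a)).1
  mul_inv x a := (τ.isTransversal.mem_fiber _ _ _ (τ.val_mem_idemOf hE x a)).2
  smul x a b h := by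
    have h1 := τ.mul_mem 1 x (E.idemOf b) _ _ (τ.isTransversal.one _) _ (τ.val_mem_idemOf hE x a)
    rw [one_mul] at h1
    refine (τ.eq_val hE ?_ h1).symm
    change E.i (b * a * (b * (a : A))⁻¹) = E.i (b * b⁻¹) * E.i (a * (a : A)⁻¹) * (E.i (b * b⁻¹))⁻¹
    rw [inv_eq_self (isIdempotentElem_i.2 (idem_mul_inv b)), ← map_mul, ← map_mul,
      mul_right_comm (b * b⁻¹), (idem_mul_inv b).eq, mul_mul_mul_inv]

/-- For `u` over `θ_x(b)` the domain idempotent is `i(b b⁻¹)`, so the idempotent `u i(b b⁻¹) u⁻¹` in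
the product rule is just `u u⁻¹`. -/
theorem isMultiplicative (hE : E.IsExtensionOf P) (τ : E.Splitting) :
    P.IsMultiplicative (τ.val hE) := fun x y b hx hy => by
  have h1 := τ.mul_mem x y _ _ _ (τ.val_mem_idemOf hE x (P.θ x ⟨b, hx⟩)) _
    (τ.val_mem_idemOf hE y ⟨b, hy⟩)
  refine τ.eq_val hE ?_ h1
  have hσ := τ.isOrderedSection hE
  set u := τ.val hE x (P.θ x ⟨b, hx⟩) with hu
  change E.i ((P.θ x ⟨b, hx⟩ : A) * (P.θ x ⟨b, hx⟩ : A)⁻¹) = u * E.i (b * b⁻¹) * u⁻¹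
  rw [← hE.inv_mul_of_mul_inv ⟨b, hx⟩ (hσ.j_eq _ _) (hσ.mul_inv _ _), ← hσ.mul_inv, ← hu,
    ← mul_assoc, mul_inv_mul_self]

/-- The splitting built from `σ` records its values at idempotents only; nothing is lost, as `σ` is
constant on components. -/
theorem exists_val_eq (hE : E.IsExtensionOf P) (hσ : E.IsOrderedSection P σ)
    (hm : P.IsMultiplicative σ) : ∃ τ : E.Splitting, τ.val hE = σ := by
  obtain ⟨τ, hτ⟩ := hσ.exists_splitting hE hm
  refine ⟨τ, funext fun x => funext fun a => ?_⟩
  have hmem : (a : A) * (a : A)⁻¹ ∈ P.D x := (P.D x).mul_inv_mem_iff a |>.2 a.2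
  rw [← τ.eq_val hE rfl (hτ x ⟨(a : A) * (a : A)⁻¹, hmem⟩ (E.idemOf (a : A)) rfl)]
  refine hσ.congr rfl _ _ ?_
  change (a : A) * (a : A)⁻¹ * ((a : A) * (a : A)⁻¹)⁻¹ = _
  rw [inv_eq_self (idem_mul_inv _), (idem_mul_inv _).eq]

end Splitting

/-! ### Conjugators and invertible multipliers of `A` -/

/-- Being below `η(e)` in a prescribed component leaves one possibility, by `eq_of_natLE`.
Monotonicity is thus the compatibility condition that `Multiplier.exists_unit` asks for. -/
theorem IsConjugator.eq_mul {η : Idem U → A} (hη : E.IsConjugator η) (a b : A) :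
    η (E.idemOf (a * b)) = η (E.idemOf a) * (b * b⁻¹) := by
  have hm : ∀ c, η (E.idemOf c) * (η (E.idemOf c))⁻¹ = c * c⁻¹ := fun c =>
    E.i_injective (hη.mem (E.idemOf c))
  have h := eq_of_natLE (hη.mono (E.idemOf (a * b)) (E.idemOf a)
    ⟨E.i (b * b⁻¹), isIdempotentElem_i.2 (idem_mul_inv b), by
      change E.i (a * b * (a * b)⁻¹) = E.i (b * b⁻¹) * E.i (a * a⁻¹)
      rw [← map_mul, mul_comm a b, mul_mul_mul_inv]⟩)
  rw [h, hm, mul_comm a b, mul_mul_mul_inv, mul_assoc, ← hm a, mul_inv_mul_self, mul_comm]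

/-- An order-preserving choice of elements in the components of `A` is an invertible multiplier. -/
theorem IsConjugator.exists_unit {η : Idem U → A} (hη : E.IsConjugator η) :
    ∃ m : (Multiplier A)ˣ, ∀ a, m.val.left a = η (E.idemOf a) * a :=
  Multiplier.exists_unit _ hη.eq_mul fun a => E.i_injective (hη.mem (E.idemOf a))

variable (E) in
/-- Every invertible multiplier of `A` defines a conjugator. -/
theorem exists_isConjugator (m : (Multiplier A)ˣ) :
    ∃ η : Idem U → A, E.IsConjugator η ∧ ∀ (a : A) (e : Idem U), E.i a = e → η e = m.val.left a := by
  choose p hp using E.exists_preimage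
  have hid : ∀ e, IsIdempotentElem (p e) := fun e => isIdempotentElem_i.1 (hp e ▸ e.2)
  refine ⟨fun e => m.val.left (p e), ⟨fun e f hef => ?_, fun e => ?_⟩, fun a e h => ?_⟩
  · obtain ⟨g, hg, hgf⟩ := hef
    refine ⟨p ⟨g, hg⟩, hid _, ?_⟩
    rw [← Multiplier.left_mul_right]
    refine congrArg _ (E.i_injective ?_)
    rw [map_mul, hp, hp, hp, hgf]
  · rw [Multiplier.unit_left_mul_inv, inv_eq_self (hid e), (hid e).eq, hp]
  · exact congrArg _ (E.i_injective ((hp e).trans h.symm))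

/-! ### Equivalence of splittings and cohomology classes -/

namespace Splitting

/-- Splittings are equivalent iff their cocycles are cohomologous. -/
theorem equiv_iff (hE : E.IsExtensionOf P) {τ₀ τ τ' : E.Splitting} {w w' : P.C1}
    (h : E.Differ P (τ₀.val hE) (τ.val hE) w) (h' : E.Differ P (τ₀.val hE) (τ'.val hE) w') :
    Splitting.Equiv τ' τ ↔ w⁻¹ * w' ∈ P.B1 := by
  have hσ₀ := τ₀.isOrderedSection hE
  have hσ := τ.isOrderedSection hE
  have hσ' := τ'.isOrderedSection hE
  have hmem : ∀ (m : P.C0) (I : SIdeal A) (b : I), m.val.left (b : A) ∈ I := fun m I b => by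
    rw [← SIdeal.mul_inv_mem_iff, Multiplier.unit_left_mul_inv, SIdeal.mul_inv_mem_iff]
    exact b.2
  -- The coboundary condition, carried into `U` by multiplying with `τ₀`: it says that `m`
  -- conjugates `τ'` into `τ`, written without inverses.
  have hm : ∀ m : P.C0, P.δ0 m = w⁻¹ * w' ↔ ∀ (x : G) (b : P.D x⁻¹),
      τ.val hE x (P.θ x b) * E.i (m.val.left b) =
        E.i (m.val.left (P.θ x b)) * τ'.val hE x (P.θ x b) := fun m => by
    rw [P.δ0_eq_iff]
    refine forall_congr' fun x => forall_congr' fun b => ?_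
    set a := P.θ x b
    set c : P.D x⁻¹ := ⟨m.val.left b, hmem m _ b⟩
    set d : P.D x := ⟨m.val.left a, hmem m _ a⟩
    have hc : (P.θ x c : A) * (P.θ x c : A)⁻¹ = (a : A) * (a : A)⁻¹ :=
      θ_mul_inv x (Multiplier.unit_left_mul_inv m (b : A))
    have hd : (d : A) * (d : A)⁻¹ = (a : A) * (a : A)⁻¹ := Multiplier.unit_left_mul_inv m (a : A)
    have h1 : E.i ((w x).val.left (P.θ x c)) * τ₀.val hE x a =
        τ.val hE x a * E.i (m.val.left b) := by
      rw [← hσ₀.congr rfl _ a hc, h, hσ.i_θ_mul hE, ← hσ.congr rfl _ a hc]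
    have h2 : E.i ((w' x).val.left d) * τ₀.val hE x a =
        E.i (m.val.left a) * τ'.val hE x a := by
      rw [← hσ₀.congr rfl _ a hd, h', ← hσ'.congr rfl _ a hd]
    rw [← h1, ← h2]
    refine ⟨fun h => congrArg (fun c : P.D x => E.i c * τ₀.val hE x a) h, fun h =>
      Subtype.ext (hσ₀.cancel ((left_mul_inv w _ _).trans hc) ((left_mul_inv w' _ _).trans hd) h)⟩
  have hconj : ∀ (x : G) (b : P.D x⁻¹),
      (conjIdem' (τ'.val hE x (P.θ x b)) (E.idemOf (P.θ x b : A))) = E.idemOf (b : A) :=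
    fun x b => Subtype.ext ((conjIdem'_of_fiber (E := E)
      ⟨hσ'.j_eq x _, hσ'.mul_inv x _⟩).trans (hE.inv_mul_of_mul_inv b (hσ'.j_eq _ _)
        (hσ'.mul_inv _ _)))
  constructor
  · rintro ⟨η, hη, hηe⟩
    obtain ⟨m, hmη⟩ := hη.exists_unit
    refine ⟨m, (hm m).2 fun x b => ?_⟩
    have h1 := τ.eq_val hE rfl (hηe x _ _ (τ'.val_mem_idemOf hE x (P.θ x b)))
    rw [hconj] at h1
    have h2 : (E.i (η (E.idemOf (b : A))))⁻¹ * E.i (η (E.idemOf (b : A))) =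
        (τ'.val hE x (P.θ x b))⁻¹ * τ'.val hE x (P.θ x b) :=
      (hη.inv_mul _).trans
        (hE.inv_mul_of_mul_inv b (hσ'.j_eq x (P.θ x b)) (hσ'.mul_inv _ _)).symm
    -- The multiplier acts by `a ↦ η(a a⁻¹) a`; the extra factor `θ_x(b)` becomes `b` on passing
    -- `τ'`, and `η⁻¹ η` is the domain idempotent of `τ'`.
    rw [← h1, hmη, hmη, map_mul, map_mul, mul_assoc (E.i (η _)) (E.i (P.θ x b)), hσ'.i_θ_mul hE]
    calc _ = E.i (η (E.idemOf (P.θ x b : A))) * (τ'.val hE x (P.θ x b) *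
          ((E.i (η (E.idemOf (b : A))))⁻¹ * E.i (η (E.idemOf (b : A))))) * E.i b := by
            simp only [mul_assoc]
      _ = _ := by rw [h2, ← mul_assoc (τ'.val hE x _), mul_inv_mul_self, mul_assoc]
  · rintro ⟨m, hmw⟩
    have hm' := (hm m).1 hmw
    obtain ⟨η, hη, hηm⟩ := E.exists_isConjugator m
    refine ⟨η, hη, fun x e u hu => ?_⟩
    obtain ⟨a, ha⟩ := E.exists_preimage e
    have hid : IsIdempotentElem a := isIdempotentElem_i.1 (ha ▸ e.2)
    have hae : E.i (a * a⁻¹) = e := by rw [inv_eq_self hid, hid.eq, ha]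
    have hax : a ∈ P.D x :=
      (hE.fiber_nonempty_iff x a e hae).1 ⟨u, τ'.isTransversal.mem_fiber _ _ _ hu⟩
    -- Only idempotent `b` is needed here: `m` at `b` and at `θ_x(b)` then gives the two values of
    -- `η` in the conjugation formula.
    obtain ⟨b, hb⟩ := (P.θ x).surjective ⟨a, hax⟩
    have hbid : IsIdempotentElem (b : A) := by
      have : b * b = b := (P.θ x).injective (by rw [map_mul, hb]; exact Subtype.ext hid)
      exact congrArg Subtype.val this
    have hba : (P.θ x b : A) = a := congrArg Subtype.val hb
    have he : E.idemOf (P.θ x b : A) = e := Subtype.ext (by rw [hba]; exact hae)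
    have hu' : u = τ'.val hE x (P.θ x b) := τ'.eq_val hE (by rw [hba, hae]) hu
    have hbi : E.i b = E.idemOf (b : A) := by
      change _ = E.i ((b : A) * (b : A)⁻¹)
      rw [inv_eq_self hbid, hbid.eq]
    have h1 := hconj x b
    rw [he, ← hu'] at h1
    have h2 := hm' x b
    rw [← hu'] at h2
    have h3 := hE.inv_mul_of_mul_inv b (hσ.j_eq x (P.θ x b)) (hσ.mul_inv _ _)
    rw [h1, hηm b _ hbi, hηm (P.θ x b) e (by rw [hba, ha]), ← h2, mul_assoc, i_mul_inv,
      Multiplier.unit_left_mul_inv, ← h3, ← mul_assoc, mul_inv_mul_self]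
    have := τ.val_mem_idemOf hE x (P.θ x b)
    rwa [he] at this

/-- For a fixed splitting `τ₀`, the classes of splittings correspond to the cohomology classes of
the cocycles by which the splittings differ from `τ₀`. -/
theorem exists_equiv (hE : E.IsExtensionOf P) (τ₀ : E.Splitting) :
    ∃ Φ : E.SplittingClass ≃ P.H1, ∀ τ : E.Splitting, ∃ w : P.Z1,
      Φ (Quotient.mk _ τ) = QuotientGroup.mk w ∧ E.Differ P (τ₀.val hE) (τ.val hE) w := by
  have hex : ∀ τ : E.Splitting, ∃ w : P.Z1, E.Differ P (τ₀.val hE) (τ.val hE) w := fun τ => by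
    obtain ⟨w, hw, hd⟩ := exists_differ hE (τ₀.isOrderedSection hE) (τ.isOrderedSection hE)
      (τ₀.isMultiplicative hE) (τ.isMultiplicative hE)
    exact ⟨⟨w, hw⟩, hd⟩
  choose W hW using hex
  have hiff : ∀ (τ τ' : E.Splitting) (w w' : P.Z1), E.Differ P (τ₀.val hE) (τ.val hE) w →
      E.Differ P (τ₀.val hE) (τ'.val hE) w' →
      (Splitting.Equiv τ' τ ↔ (QuotientGroup.mk w : P.H1) = QuotientGroup.mk w') :=
    fun τ τ' w w' h h' => by
      rw [equiv_iff hE h h', QuotientGroup.eq, Subgroup.mem_subgroupOf]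
      rfl
  let F : E.SplittingClass → P.H1 := Quotient.lift (fun τ => QuotientGroup.mk (W τ))
    fun τ τ' h => ((hiff τ' τ _ _ (hW τ') (hW τ)).1 h).symm
  refine ⟨Equiv.ofBijective F ⟨?_, ?_⟩, fun τ => ⟨W τ, rfl, hW τ⟩⟩
  · intro c c'
    induction c using Quotient.inductionOn with | _ τ
    induction c' using Quotient.inductionOn with | _ τ'
    exact fun h => Quotient.sound ((hiff τ' τ _ _ (hW τ') (hW τ)).2 h.symm)
  · intro c
    obtain ⟨w, rfl⟩ := QuotientGroup.mk_surjective c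
    obtain ⟨σ, hσ, hm, hd⟩ := exists_section hE (τ₀.isOrderedSection hE)
      (τ₀.isMultiplicative hE) w.2
    obtain ⟨τ, rfl⟩ := exists_val_eq hE hσ hm
    -- The chosen cocycle `W τ` and the given `w` both compare `τ₀` with the same `τ`, so
    -- reflexivity already makes them cohomologous.
    exact ⟨Quotient.mk _ τ, (hiff τ τ _ _ (hW τ) hd).1 ((equiv_equivalence E).refl τ)⟩

end Splitting

end Extension

end PartialCohomology

theorem mainTheorem3 {G : Type*} {A : Type*} {U : Type*} [Group G]
    [PartialCohomology.CommInverseSemigroup A] [PartialCohomology.InverseSemigroup U]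
    (P : PartialCohomology.PartialAction G A) (E : PartialCohomology.Extension A U G)
    (hE : E.IsExtensionOf P) (hsplit : E.Splits) :
    Nonempty (E.SplittingClass ≃ P.H1) ∧
    ∀ τ₀ : E.Splitting, ∃ Φ : E.SplittingClass ≃ P.H1,
      ∀ τ : E.Splitting, ∃ w : P.Z1,
        Φ (Quotient.mk _ τ) = QuotientGroup.mk w ∧
        ∀ (x : G) (e : PartialCohomology.Idem U) (a : P.D x), E.i a = e →
          ∀ u ∈ τ₀.τ (x, e), E.i (((w : P.C1) x : PartialCohomology.Multiplier (P.D x)).left a) * u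
            ∈ τ.τ (x, e) := by
  refine ⟨?_, fun τ₀ => ?_⟩
  · obtain ⟨τ₀⟩ := hsplit
    obtain ⟨Φ, -⟩ := PartialCohomology.Extension.Splitting.exists_equiv hE τ₀
    exact ⟨Φ⟩
  · obtain ⟨Φ, hΦ⟩ := PartialCohomology.Extension.Splitting.exists_equiv hE τ₀
    refine ⟨Φ, fun τ => ?_⟩
    obtain ⟨w, hw, hd⟩ := hΦ τ
    refine ⟨w, hw, fun x e a ha u hu => ?_⟩
    have he : E.idemOf (a : A) = e := PartialCohomology.Extension.Splitting.idemOf_eq ha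
    have hmem := τ.val_mem_idemOf hE x a
    -- For `i(a) = e` the relation `Differ` reads `i(w(x) a) τ₀(x, e) = e τ(x, e)`, and `e` is the
    -- range idempotent of `τ(x, e)`.
    rw [τ₀.eq_val hE (a := a) (congrArg Subtype.val he) hu, hd, ha, ← he,
      show (E.idemOf (a : A) : U) = _ from ((τ.isOrderedSection hE).mul_inv x a).symm,
      PartialCohomology.InverseSemigroup.mul_inv_mul_self]
    exact hmem
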